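/- Let $U\subset\mathbb R^4$ be a nonempty convex open set with coordinates $(x,y,z,w)$ (for instance $U=\mathbb R^4$), and let $J\subset\mathbb R$ be its projection to the $z$-axis. Here $z=t_4$, and a dot is $d/dz$. Consider the first higher-order KP equation $$w_{xxxxy}+6w_{xx}w_{xy}+4w_xw_{xxy}+2w_{xxx}w_y-2w_{xxz}+w_{yyy}=0 .$$ A Lie point symmetry on $U$ is a real $C^\infty$ vector field $\xi\partial_x+\eta\partial_y+\tau\partial_z+\phi\partial_w$ on $U$ whose prolongation to jets, applied to the left-hand side $\Delta$ of the equation, vanishes at all jets over $U$ at which $\Delta=0$. For $f,g,h,k\in C^\infty(J)$ put $$Z(f)=f\partial_z+\tfrac14\dot f\,(x\partial_x+2y\partial_y)-\tfrac14(w\dot f+xy\ddot f)\partial_w,\quad Y(g)=g\partial_y-\tfrac12x\dot g\,\partial_w,\quad X(h)=h\partial_x-y\dot h\,\partial_w,\quad W(k)=k\partial_w .$$ Then: 1. The Lie point symmetries on $U$ form a real Lie algebra, and they are exactly the fields $Z(f)+Y(g)+X(h)+W(k)$ with $f,g,h,k\in C^\infty(J)$ arbitrary; $f,g,h,k$ are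 uniquely determined by the field. 2. The $Z(f)$ form a centerless Virasoro algebra: $[Z(f_1),Z(f_2)]=Z(f_1\dot f_2-\dot f_1f_2)$, and $f\partial_z\mapsto Z(f)$ is an injective Lie algebra homomorphism from the vector fields on $J$. In particular, if $0\notin J$, then $L_n=Z(-z^{n+1})$, $n\in\mathbb Z$, satisfy $[L_m,L_n]=(m-n)L_{m+n}$. 3. The $Z(f)$ act on the other fields by $[Z(f),Y(g)]=Y(f\dot g-\tfrac12\dot fg)$, $[Z(f),X(h)]=X(f\dot h-\tfrac14\dot fh)$, $[Z(f),W(k)]=W(f\dot k+\tfrac14\dot fk)$. Among the other fields the only nonzero commutators are $[X(h),Y(g)]=W(g\dot h-\tfrac12\dot gh)$. 4. Let $\mathfrak h$ be the 5-dimensional Heisenberg algebra, with basis $A_1,A_2,B_1,B_2,H$ and nonzero brackets $[A_i,B_i]=H$. It is realized faithfully on $U$ by the fields $A_1=\partial_x$, $A_2=\partial_y$, $B_1=x\partial_w$, $B_2=y\partial_w$, $H=\partial_w$. With $z$ as loop parameter, this realization extends to an injective Lie algebra homomorphism $\rho$ from the loop algebra $C^\infty(J,\mathfrak h)$ (pointwise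 bracket) to the vector fields on $U$. The fields $Y(g)+X(h)+W(k)$ form a Lie algebra contained in the image of $\rho$, namely $Y(g)+X(h)+W(k)=\rho\bigl(hA_1+gA_2-\tfrac12\dot g\,B_1-\dot h\,B_2+kH\bigr)$. The values of these loops at each $z\in J$ fill all of $\mathfrak h$, and the loops generate $C^\infty(J,\mathfrak h)$ as a $C^\infty(J)$-module. 5. $\mathfrak h$ embeds in $\mathrm{sl}(4,\mathbb R)$: the map $$a_1A_1+a_2A_2+b_1B_1+b_2B_2+cH\ \mapsto\ \begin{pmatrix}0&b_1&b_2&-c\\0&0&0&a_1\\0&0&0&a_2\\0&0&0&0\end{pmatrix}$$ is an injective Lie algebra homomorphism. -/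

import Mathlib

open scoped ContDiff

noncomputable section

namespace HigherKP

open TopologicalSpace VectorField

/-! ### Smooth maps and smooth vector fields on an open set -/

section Smooth

variable {E : Type*} [NormedAddCommGroup E] [NormedSpace ℝ E]

/-- The real vector space of `C^∞` maps `U → F` on an open set `U`. A map on `U` is represented
by its extension by zero to the whole space. -/
def SmoothMap (U : Opens E) (F : Type*) [NormedAddCommGroup F] [NormedSpace ℝ F] :
    Submodule ℝ (E → F) where
  carrier := {f | ContDiffOn ℝ ∞ f U ∧ ∀ p ∉ U, f p = 0}
  add_mem' := fun hf hg => ⟨hf.1.add hg.1, fun p hp => by simp [hf.2 p hp, hg.2 p hp]⟩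
  zero_mem' := ⟨contDiffOn_const, fun _ _ => rfl⟩
  smul_mem' := fun c _ hf => ⟨hf.1.const_smul c, fun p hp => by simp [hf.2 p hp]⟩

variable {F : Type*} [NormedAddCommGroup F] [NormedSpace ℝ F]

/-- The element of `SmoothMap U F` that agrees on `U` with a map smooth on `U`. -/
def ofSmoothOn (U : Opens E) (f : E → F) (hf : ContDiffOn ℝ ∞ f U) : SmoothMap U F :=
  ⟨Set.indicator (U : Set E) f,
    hf.congr fun _ hp => Set.indicator_of_mem hp f,
    fun _ hp => Set.indicator_of_notMem hp f⟩

theorem ofSmoothOn_apply {U : Opens E} {f : E → F} (hf : ContDiffOn ℝ ∞ f U) {p : E}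
    (hp : p ∈ U) : (ofSmoothOn U f hf).1 p = f p :=
  Set.indicator_of_mem hp f

theorem SmoothMap.ext_on {U : Opens E} {f g : SmoothMap U F} (h : ∀ p ∈ U, f.1 p = g.1 p) :
    f = g := by
  apply Subtype.ext
  funext p
  by_cases hp : p ∈ U
  · exact h p hp
  · rw [f.2.2 p hp, g.2.2 p hp]

theorem SmoothMap.contDiffAt {U : Opens E} (f : SmoothMap U F) {p : E} (hp : p ∈ U) :
    ContDiffAt ℝ ∞ f.1 p :=
  f.2.1.contDiffAt (U.isOpen.mem_nhds hp)

theorem SmoothMap.differentiableAt {U : Opens E} (f : SmoothMap U F) {p : E} (hp : p ∈ U) :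
    DifferentiableAt ℝ f.1 p :=
  (SmoothMap.contDiffAt f hp).differentiableAt (by simp)

/-- The smooth vector fields on the open set `U`. -/
def VF (U : Opens E) : Type _ := SmoothMap U E

instance (U : Opens E) : AddCommGroup (VF U) := inferInstanceAs (AddCommGroup (SmoothMap U E))
instance (U : Opens E) : Module ℝ (VF U) := inferInstanceAs (Module ℝ (SmoothMap U E))
instance (U : Opens E) : CoeFun (VF U) (fun _ => E → E) := ⟨fun V => V.1⟩

theorem VF.ext_on {U : Opens E} {V W : VF U} (h : ∀ p ∈ U, V p = W p) : V = W :=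
  SmoothMap.ext_on h

theorem VF.diff {U : Opens E} (V : VF U) {p : E} (hp : p ∈ U) : DifferentiableAt ℝ V p :=
  SmoothMap.differentiableAt V hp

theorem VF.add_coe {U : Opens E} (V W : VF U) : (V + W : VF U).1 = V.1 + W.1 := rfl

theorem VF.smul_coe {U : Opens E} (c : ℝ) (V : VF U) : (c • V : VF U).1 = c • V.1 := rfl

/-- The commutator of vector fields on `U`: `[V, W] = (DW) V - (DV) W`. -/
instance (U : Opens E) : Bracket (VF U) (VF U) where
  bracket V W := ofSmoothOn U (lieBracket ℝ V.1 W.1) fun p hp =>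
    ((SmoothMap.contDiffAt V hp).lieBracket_vectorField (SmoothMap.contDiffAt W hp)
      (by simp)).contDiffWithinAt

theorem VF.lie_apply {U : Opens E} (V W : VF U) {p : E} (hp : p ∈ U) :
    ⁅V, W⁆.1 p = lieBracket ℝ V.1 W.1 p :=
  ofSmoothOn_apply _ hp

theorem VF.lie_eventuallyEq {U : Opens E} (V W : VF U) {p : E} (hp : p ∈ U) :
    ⁅V, W⁆.1 =ᶠ[nhds p] lieBracket ℝ V.1 W.1 := by
  filter_upwards [U.isOpen.mem_nhds hp] with q hq
  exact VF.lie_apply V W hq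

instance [CompleteSpace E] (U : Opens E) : LieRing (VF U) where
  add_lie V W X := VF.ext_on fun p hp => by
    rw [VF.add_coe, Pi.add_apply, VF.lie_apply _ _ hp, VF.lie_apply _ _ hp, VF.lie_apply _ _ hp]
    exact lieBracket_add_left (V.diff hp) (W.diff hp)
  lie_add V W X := VF.ext_on fun p hp => by
    rw [VF.add_coe, Pi.add_apply, VF.lie_apply _ _ hp, VF.lie_apply _ _ hp, VF.lie_apply _ _ hp]
    exact lieBracket_add_right (W.diff hp) (X.diff hp)
  lie_self V := VF.ext_on fun p hp => by
    rw [VF.lie_apply _ _ hp, lieBracket_self]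
    rfl
  leibniz_lie V W X := VF.ext_on fun p hp => by
    rw [VF.add_coe, Pi.add_apply, VF.lie_apply _ _ hp, VF.lie_apply _ _ hp, VF.lie_apply _ _ hp,
      (Filter.EventuallyEq.refl _ V.1).lieBracket_vectorField_eq (VF.lie_eventuallyEq W X hp),
      (VF.lie_eventuallyEq V W hp).lieBracket_vectorField_eq (Filter.EventuallyEq.refl _ X.1),
      (Filter.EventuallyEq.refl _ W.1).lieBracket_vectorField_eq (VF.lie_eventuallyEq V X hp)]
    have hn : minSmoothness ℝ 2 ≤ (∞ : WithTop ℕ∞) := by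
      rw [minSmoothness_of_isRCLikeNormedField]
      exact WithTop.coe_le_coe.2 (le_top : (2 : ℕ∞) ≤ ⊤)
    exact leibniz_identity_lieBracket hn (SmoothMap.contDiffAt V hp) (SmoothMap.contDiffAt W hp)
      (SmoothMap.contDiffAt X hp)

instance [CompleteSpace E] (U : Opens E) : LieAlgebra ℝ (VF U) where
  lie_smul c V W := VF.ext_on fun p hp => by
    rw [VF.smul_coe, Pi.smul_apply, VF.lie_apply _ _ hp, VF.lie_apply _ _ hp]
    exact lieBracket_const_smul_right (W.diff hp)

end Smooth

/-! ### Smooth functions of the time variable -/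

/-- The algebra of smooth real functions on an open set `J` of the line. -/
abbrev CInf (J : Opens ℝ) : Type := SmoothMap J ℝ

instance (J : Opens ℝ) : Mul (CInf J) where
  mul f g := ⟨f.1 * g.1, f.2.1.mul g.2.1, fun z hz => by simp [f.2.2 z hz]⟩

theorem CInf.contDiffOn_deriv {J : Opens ℝ} {f : ℝ → ℝ} (hf : ContDiffOn ℝ ∞ f J) :
    ContDiffOn ℝ ∞ (deriv f) J :=
  hf.deriv_of_isOpen J.isOpen (by simp)

/-- The derivative of a smooth function on `J`. -/
def CInf.D {J : Opens ℝ} (f : CInf J) : CInf J :=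
  ofSmoothOn J (deriv f.1) (CInf.contDiffOn_deriv f.2.1)

/-- The vector field `f d/dz` on `J`. -/
def CInf.toVF {J : Opens ℝ} (f : CInf J) : VF J := f

/-! ### Jets, total derivatives and prolongation

The independent variables are `x, y, z` (indices `0, 1, 2`), the dependent variable is `w`.
A point of the space of independent and dependent variables is `![x, y, z, w]`. -/

/-- The (infinite) jet space: a value of `(x, y, z)` and, for each multi-index `α`, a value of
the jet coordinate `w_α`. -/
abbrev Jet := (Fin 3 → ℝ) × ((Fin 3 → ℕ) → ℝ)

/-- The point `(x, y, z, w)` below a jet. -/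
def Jet.pt (j : Jet) : Fin 4 → ℝ := ![j.1 0, j.1 1, j.1 2, j.2 0]

/-- The total derivative `D_i = ∂/∂x^i + ∑_α w_{α + e_i} ∂/∂w_α`. -/
def totalDeriv (i : Fin 3) (F : Jet → ℝ) (j : Jet) : ℝ :=
  lineDeriv ℝ F j (Pi.single i 1, fun α => j.2 (α + Pi.single i 1))

/-- The iterated total derivative `D^α = D_x^{α_0} D_y^{α_1} D_z^{α_2}`. -/
def totalDerivIter (α : Fin 3 → ℕ) (F : Jet → ℝ) : Jet → ℝ :=
  (totalDeriv 0)^[α 0] ((totalDeriv 1)^[α 1] ((totalDeriv 2)^[α 2] F))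

/-- The characteristic `Q = φ - ξ w_x - η w_y - τ w_z` of the vector field
`ξ ∂_x + η ∂_y + τ ∂_z + φ ∂_w`. -/
def characteristic (V : (Fin 4 → ℝ) → (Fin 4 → ℝ)) (j : Jet) : ℝ :=
  V j.pt 3 - ∑ i : Fin 3, V j.pt i.castSucc * j.2 (Pi.single i 1)

/-- The prolongation of the vector field `V` to the jet space. Its component along `x^i` is that
of `V`; its component along `w_α` is `φ^α = D^α Q + ∑_i ξ^i w_{α + e_i}`. -/
def prolongation (V : (Fin 4 → ℝ) → (Fin 4 → ℝ)) (j : Jet) : Jet :=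
  (fun i => V j.pt i.castSucc,
   fun α => totalDerivIter α (characteristic V) j +
     ∑ i : Fin 3, V j.pt i.castSucc * j.2 (α + Pi.single i 1))

/-- `V` is an infinitesimal Lie point symmetry of the differential equation `Δ = 0`: the
prolongation of `V`, applied to `Δ`, vanishes at every jet over `U` that satisfies `Δ = 0`. -/
def IsLiePointSymmetry (Δ : Jet → ℝ) {U : Opens (Fin 4 → ℝ)} (V : VF U) : Prop :=
  ∀ j : Jet, j.pt ∈ U → Δ j = 0 → lineDeriv ℝ Δ j (prolongation V j) = 0

/-- The left-hand side of the first higher-order KP equation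
`w_xxxxy + 6 w_xx w_xy + 4 w_x w_xxy + 2 w_xxx w_y - 2 w_xxz + w_yyy = 0`. -/
def higherKP (j : Jet) : ℝ :=
  j.2 ![4, 1, 0] + 6 * j.2 ![2, 0, 0] * j.2 ![1, 1, 0] + 4 * j.2 ![1, 0, 0] * j.2 ![2, 1, 0]
    + 2 * j.2 ![3, 0, 0] * j.2 ![0, 1, 0] - 2 * j.2 ![2, 0, 1] + j.2 ![0, 3, 0]

/-! ### The vector fields `Z(f)`, `Y(g)`, `X(h)`, `W(k)` -/

section Fields

variable (U : Opens (Fin 4 → ℝ))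

/-- The set of values of `z` on `U`. -/
def zRange : Opens ℝ :=
  ⟨(fun p : Fin 4 → ℝ => p 2) '' U, isOpenMap_eval 2 _ U.isOpen⟩

variable {U}

theorem comp_z {f : ℝ → ℝ} (hf : ContDiffOn ℝ ∞ f (zRange U)) :
    ContDiffOn ℝ ∞ (fun p : Fin 4 → ℝ => f (p 2)) U :=
  hf.comp (contDiff_apply ℝ ℝ (2 : Fin 4)).contDiffOn fun p hp => ⟨p, hp, rfl⟩

theorem coord (i : Fin 4) : ContDiffOn ℝ ∞ (fun p : Fin 4 → ℝ => p i) U :=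
  (contDiff_apply ℝ ℝ i).contDiffOn

theorem vec4 {a b c d : (Fin 4 → ℝ) → ℝ} (ha : ContDiffOn ℝ ∞ a U) (hb : ContDiffOn ℝ ∞ b U)
    (hc : ContDiffOn ℝ ∞ c U) (hd : ContDiffOn ℝ ∞ d U) :
    ContDiffOn ℝ ∞ (fun p => (![a p, b p, c p, d p] : Fin 4 → ℝ)) U := by
  rw [contDiffOn_pi]
  intro i
  fin_cases i
  · exact ha
  · exact hb
  · exact hc
  · exact hd

variable (U)

/-- `Z(f) = f ∂_z + (1/4) f' (x ∂_x + 2 y ∂_y) - (1/4) (w f' + x y f'') ∂_w`. -/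
def Z (f : CInf (zRange U)) : VF U :=
  ofSmoothOn U
    (fun p => ![1 / 4 * deriv f.1 (p 2) * p 0, 1 / 4 * deriv f.1 (p 2) * (2 * p 1), f.1 (p 2),
      -(1 / 4) * (p 3 * deriv f.1 (p 2) + p 0 * p 1 * deriv (deriv f.1) (p 2))])
    (by
      have h0 := comp_z f.2.1
      have h1 := comp_z (CInf.contDiffOn_deriv f.2.1)
      have h2 := comp_z (CInf.contDiffOn_deriv (CInf.contDiffOn_deriv f.2.1))
      exact vec4 ((contDiffOn_const.mul h1).mul (coord 0))
        ((contDiffOn_const.mul h1).mul (contDiffOn_const.mul (coord 1))) h0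
        (contDiffOn_const.mul (((coord 3).mul h1).add (((coord 0).mul (coord 1)).mul h2))))

/-- `Y(g) = g ∂_y - (1/2) x g' ∂_w`. -/
def Y (g : CInf (zRange U)) : VF U :=
  ofSmoothOn U (fun p => ![0, g.1 (p 2), 0, -(1 / 2) * p 0 * deriv g.1 (p 2)])
    (vec4 contDiffOn_const (comp_z g.2.1) contDiffOn_const
      ((contDiffOn_const.mul (coord 0)).mul (comp_z (CInf.contDiffOn_deriv g.2.1))))

/-- `X(h) = h ∂_x - y h' ∂_w`. -/
def X (h : CInf (zRange U)) : VF U :=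
  ofSmoothOn U (fun p => ![h.1 (p 2), 0, 0, -p 1 * deriv h.1 (p 2)])
    (vec4 (comp_z h.2.1) contDiffOn_const contDiffOn_const
      ((coord 1).neg.mul (comp_z (CInf.contDiffOn_deriv h.2.1))))

/-- `W(k) = k ∂_w`. -/
def W (k : CInf (zRange U)) : VF U :=
  ofSmoothOn U (fun p => ![0, 0, 0, k.1 (p 2)])
    (vec4 contDiffOn_const contDiffOn_const contDiffOn_const (comp_z k.2.1))

end Fields

/-! ### The Heisenberg algebra and its loop algebra -/

/-- The real Heisenberg algebra of dimension `2 n + 1`. -/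
def Heis (n : ℕ) : Type := (Fin n → ℝ) × (Fin n → ℝ) × ℝ

namespace Heis

instance (n : ℕ) : NormedAddCommGroup (Heis n) :=
  inferInstanceAs (NormedAddCommGroup ((Fin n → ℝ) × (Fin n → ℝ) × ℝ))
instance (n : ℕ) : NormedSpace ℝ (Heis n) :=
  inferInstanceAs (NormedSpace ℝ ((Fin n → ℝ) × (Fin n → ℝ) × ℝ))

variable {n : ℕ}

/-- The element `∑ a_i A_i + ∑ b_i B_i + c H`. -/
def mk (a b : Fin n → ℝ) (c : ℝ) : Heis n := (a, b, c)

/-- The coordinates along the `A_i`. -/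
def a (v : Heis n) : Fin n → ℝ := Prod.fst v

/-- The coordinates along the `B_i`. -/
def b (v : Heis n) : Fin n → ℝ := Prod.fst (Prod.snd v)

/-- The coordinate along the central element `H`. -/
def c (v : Heis n) : ℝ := Prod.snd (Prod.snd v)

theorem ext' {u v : Heis n} (ha : u.a = v.a) (hb : u.b = v.b) (hc : u.c = v.c) : u = v :=
  Prod.ext ha (Prod.ext hb hc)

/-- The bracket is determined by `[A_i, B_i] = H`, all other brackets of basis elements being
zero. -/
instance : Bracket (Heis n) (Heis n) where
  bracket u v := mk 0 0 (u.a ⬝ᵥ v.b - v.a ⬝ᵥ u.b)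

theorem lie_def (u v : Heis n) : ⁅u, v⁆ = mk 0 0 (u.a ⬝ᵥ v.b - v.a ⬝ᵥ u.b) := rfl

@[simp] theorem a_mk (a b : Fin n → ℝ) (c : ℝ) : (mk a b c).a = a := rfl
@[simp] theorem b_mk (a b : Fin n → ℝ) (c : ℝ) : (mk a b c).b = b := rfl
@[simp] theorem c_mk (a b : Fin n → ℝ) (c : ℝ) : (mk a b c).c = c := rfl
@[simp] theorem a_add (u v : Heis n) : (u + v).a = u.a + v.a := rfl
@[simp] theorem b_add (u v : Heis n) : (u + v).b = u.b + v.b := rfl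
@[simp] theorem c_add (u v : Heis n) : (u + v).c = u.c + v.c := rfl
@[simp] theorem a_zero : (0 : Heis n).a = 0 := rfl
@[simp] theorem b_zero : (0 : Heis n).b = 0 := rfl
@[simp] theorem c_zero : (0 : Heis n).c = 0 := rfl
@[simp] theorem a_smul (r : ℝ) (v : Heis n) : (r • v).a = r • v.a := rfl
@[simp] theorem b_smul (r : ℝ) (v : Heis n) : (r • v).b = r • v.b := rfl
@[simp] theorem c_smul (r : ℝ) (v : Heis n) : (r • v).c = r • v.c := rfl

instance : LieRing (Heis n) where
  add_lie u v w := by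
    apply ext' <;> simp [lie_def, add_dotProduct, dotProduct_add]
    ring
  lie_add u v w := by
    apply ext' <;> simp [lie_def, add_dotProduct, dotProduct_add]
    ring
  lie_self u := by apply ext' <;> simp [lie_def]
  leibniz_lie u v w := by apply ext' <;> simp [lie_def]

instance : LieAlgebra ℝ (Heis n) where
  lie_smul r u v := by
    apply ext' <;> simp [lie_def, smul_dotProduct, dotProduct_smul]
    ring

theorem contDiffOn_lie {J : Set ℝ} {u v : ℝ → Heis n} (hu : ContDiffOn ℝ ∞ u J)
    (hv : ContDiffOn ℝ ∞ v J) : ContDiffOn ℝ ∞ (fun z => ⁅u z, v z⁆) J := by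
  have ha : ∀ {u : ℝ → Heis n}, ContDiffOn ℝ ∞ u J → ∀ i, ContDiffOn ℝ ∞ (fun z => (u z).a i) J :=
    fun h i => contDiffOn_pi.1 (ContDiff.comp_contDiffOn contDiff_fst h) i
  have hb : ∀ {u : ℝ → Heis n}, ContDiffOn ℝ ∞ u J → ∀ i, ContDiffOn ℝ ∞ (fun z => (u z).b i) J :=
    fun h i => contDiffOn_pi.1
      (ContDiff.comp_contDiffOn contDiff_fst (ContDiff.comp_contDiffOn contDiff_snd h)) i
  refine ContDiffOn.prodMk contDiffOn_const (ContDiffOn.prodMk contDiffOn_const ?_)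
  exact (ContDiffOn.sum fun i _ => (ha hu i).mul (hb hv i)).sub
    (ContDiffOn.sum fun i _ => (ha hv i).mul (hb hu i))

end Heis

/-- The loop algebra over the Heisenberg algebra: smooth maps `J → Heis n` of the loop
parameter `z ∈ J`, with the pointwise bracket. -/
def Loop (J : Opens ℝ) (n : ℕ) : Type := SmoothMap J (Heis n)

namespace Loop

variable {J : Opens ℝ} {n : ℕ}

instance : AddCommGroup (Loop J n) := inferInstanceAs (AddCommGroup (SmoothMap J (Heis n)))
instance : Module ℝ (Loop J n) := inferInstanceAs (Module ℝ (SmoothMap J (Heis n)))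
instance : CoeFun (Loop J n) (fun _ => ℝ → Heis n) := ⟨fun c => c.1⟩

instance : Bracket (Loop J n) (Loop J n) where
  bracket c d := ⟨fun z => ⁅c z, d z⁆, Heis.contDiffOn_lie c.2.1 d.2.1,
    fun z hz => by
      have h : c z = 0 := c.2.2 z hz
      show ⁅c z, d z⁆ = 0
      rw [h, Heis.lie_def]
      apply Heis.ext' <;> simp⟩

instance : LieRing (Loop J n) where
  add_lie c d e := Subtype.ext (funext fun z => add_lie (c z) (d z) (e z))
  lie_add c d e := Subtype.ext (funext fun z => lie_add (c z) (d z) (e z))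
  lie_self c := Subtype.ext (funext fun z => lie_self (c z))
  leibniz_lie c d e := Subtype.ext (funext fun z => leibniz_lie (c z) (d z) (e z))

instance : LieAlgebra ℝ (Loop J n) where
  lie_smul r c d := Subtype.ext (funext fun z => lie_smul r (c z) (d z))

end Loop

/-- The vector field `a_0 ∂_x + a_1 ∂_y + (b_0 x + b_1 y + c) ∂_w` at the point `p`, for the
element `v` of the five-dimensional Heisenberg algebra with coordinates `a, b, c`. Thus
`A_0, A_1, B_0, B_1, H` stand for `∂_x`, `∂_y`, `x ∂_w`, `y ∂_w`, `∂_w`. -/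
def heisField (v : Heis 2) (p : Fin 4 → ℝ) : Fin 4 → ℝ :=
  ![v.a 0, v.a 1, 0, v.b 0 * p 0 + v.b 1 * p 1 + v.c]

/-- The loop `z ↦ h(z) A_0 + g(z) A_1 - (1/2) g'(z) B_0 - h'(z) B_1 + k(z) H`. -/
def kmLoop {J : Opens ℝ} (g h k : CInf J) : Loop J 2 :=
  ofSmoothOn J
    (fun z => Heis.mk ![h.1 z, g.1 z] ![-(1 / 2) * deriv g.1 z, -deriv h.1 z] (k.1 z))
    (by
      have hg := CInf.contDiffOn_deriv g.2.1
      have hh := CInf.contDiffOn_deriv h.2.1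
      refine ContDiffOn.prodMk (contDiffOn_pi.2 fun i => ?_)
        (ContDiffOn.prodMk (contDiffOn_pi.2 fun i => ?_) k.2.1)
      · fin_cases i
        · exact h.2.1
        · exact g.2.1
      · fin_cases i
        · exact contDiffOn_const.mul hg
        · exact hh.neg)

end HigherKP

end

noncomputable section

namespace HigherKP

open TopologicalSpace VectorField

section

/-! ### Partial derivatives of smooth functions -/

section Partial

variable {U : Opens (Fin 4 → ℝ)}

/-! The prolongation of V = ξ∂_x + η∂_y + τ∂_z + φ∂_w, applied to the left-hand side Δ, is a
polynomial in the jet coordinates with coefficients smooth on U. Such differential functions form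
`JetAlg`. On it total derivatives and constant fibre derivatives are honest derivations, and the
rules [D_i, D_k] = 0 (`totalD_comm`) and [∂/∂w_β, D_i] = ∂/∂w_{β-e_i} (`fiberD_totalD`) give any
coefficient of the variation without expanding it.

Necessity. The symmetry condition is available only on Δ = 0. It is tested at jets of affine
functions, whose only free derivatives are w_x = b and w_y = c; there Δ = 0. Along ∂/∂w_β + r
∂/∂w_xxxxy with |β| ≥ 3, Δ is linear in the parameter, so a suitable r keeps the line inside Δ = 0
and the variation has zero derivative along it (`jetD_kpVariation_eq_zero`). Ten choices of β, with
the powers of b or c separated, give `DeterminingEquations`.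

Sufficiency. The determining equations describe a scaling with weights 1, 2, 4, -1 of x, y, z, w,
with rate ξ_x, together with z-dependent corrections. Every term of Δ has weight -7, and indeed the
variation equals -7 ξ_x Δ identically (`kpVariation_eq`).

Integration. The slices of constant z of a convex U are convex, so vanishing x-, y- and
w-derivatives leave a function of z alone (`exists_eq_comp_z`). Thus τ = f(z); after subtracting
Z(f), ξ and η depend on z only; after subtracting X(h) and Y(g), only W(k) is left.

Algebra. One commutator formula, `lie_genField`, contains all the brackets. Fields of loops have no
∂_z component, so their commutators never differentiate the loop coefficients and are pointwise. In
the loops of Y(g) + X(h) + W(k) the B-coefficients are derivatives of the A-coefficients; since the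
value and the derivative of a function at a point are independent, these loops still fill the
Heisenberg algebra pointwise and generate all loops over the functions of z. -/

theorem contDiffOn_partial (i : Fin 4) (a : SmoothMap U ℝ) :
    ContDiffOn ℝ ∞ (fun p => fderiv ℝ a.1 p (Pi.single i 1)) U :=
  (a.2.1.fderiv_of_isOpen U.isOpen (by simp)).clm_apply contDiffOn_const

/-- The partial derivative of a smooth function on `U` along the `i`-th coordinate. -/
def pd (i : Fin 4) : SmoothMap U ℝ →ₗ[ℝ] SmoothMap U ℝ where
  toFun a := ofSmoothOn U _ (contDiffOn_partial i a)
  map_add' a b := SmoothMap.ext_on fun p hp => by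
    rw [ofSmoothOn_apply _ hp, Submodule.coe_add, Submodule.coe_add, Pi.add_apply,
      ofSmoothOn_apply _ hp, ofSmoothOn_apply _ hp,
      fderiv_add (SmoothMap.differentiableAt a hp) (SmoothMap.differentiableAt b hp)]
    rfl
  map_smul' c a := SmoothMap.ext_on fun p hp => by
    rw [ofSmoothOn_apply _ hp, RingHom.id_apply, Submodule.coe_smul, Submodule.coe_smul,
      Pi.smul_apply, ofSmoothOn_apply _ hp, fderiv_const_smul (SmoothMap.differentiableAt a hp)]
    rfl

theorem pd_apply (i : Fin 4) (a : SmoothMap U ℝ) {p : Fin 4 → ℝ} (hp : p ∈ U) :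
    (pd i a).1 p = fderiv ℝ a.1 p (Pi.single i 1) :=
  ofSmoothOn_apply (contDiffOn_partial i a) hp

theorem fderiv_eq_sum_pd (a : SmoothMap U ℝ) {p : Fin 4 → ℝ} (hp : p ∈ U) (v : Fin 4 → ℝ) :
    fderiv ℝ a.1 p v = ∑ i, (pd i a).1 p * v i := by
  conv_lhs => rw [← Finset.univ_sum_single v, map_sum]
  refine Finset.sum_congr rfl fun i _ => ?_
  have h : (Pi.single i (v i) : Fin 4 → ℝ) = v i • Pi.single i 1 := by
    rw [← Pi.single_smul, smul_eq_mul, mul_one]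
  rw [pd_apply i a hp, h, map_smul, smul_eq_mul, mul_comm]

theorem pd_comm (i k : Fin 4) (a : SmoothMap U ℝ) : pd i (pd k a) = pd k (pd i a) := by
  have key : ∀ (i k : Fin 4), ∀ p ∈ U, (pd i (pd k a)).1 p =
      fderiv ℝ (fderiv ℝ a.1) p (Pi.single i 1) (Pi.single k 1) := by
    intro i k p hp
    have hev : (pd k a).1 =ᶠ[nhds p] fun q => fderiv ℝ a.1 q (Pi.single k 1) := by
      filter_upwards [U.isOpen.mem_nhds hp] with q hq
      exact pd_apply k a hq
    have hd : DifferentiableAt ℝ (fderiv ℝ a.1) p :=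
      (((SmoothMap.contDiffAt a hp).fderiv_right (m := ∞) (by simp)).differentiableAt (by simp))
    rw [pd_apply i _ hp, hev.fderiv_eq, fderiv_clm_apply hd (differentiableAt_const _)]
    simp
  refine SmoothMap.ext_on fun p hp => ?_
  rw [key i k p hp, key k i p hp]
  have hs : IsSymmSndFDerivAt ℝ a.1 p :=
    (SmoothMap.contDiffAt a hp).isSymmSndFDerivAt (by
      rw [minSmoothness_of_isRCLikeNormedField]
      exact WithTop.coe_le_coe.2 (le_top : (2 : ℕ∞) ≤ ⊤))
  exact hs.eq _ _

end Partial

/-! ### The algebra of differential functions over `U` -/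

/-- The jets over the open set `U`. -/
abbrev JetOver (U : Opens (Fin 4 → ℝ)) : Type := {j : Jet // j.pt ∈ U}

theorem Jet.pt_add_smul (j v : Jet) (t : ℝ) : (j + t • v).pt = j.pt + t • v.pt := by
  funext i
  fin_cases i <;> simp [Jet.pt]

theorem Jet.pt_castSucc (j : Jet) (i : Fin 3) : j.pt i.castSucc = j.1 i := by
  fin_cases i <;> rfl

variable {U : Opens (Fin 4 → ℝ)}

/-- Being over U is an open condition along each line, so line derivatives at a jet over U see only
values over U. This makes extension by zero harmless. -/
theorem JetOver.eventually_mem (j : JetOver U) (v : Jet) :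
    ∀ᶠ t : ℝ in nhds 0, (j.1 + t • v).pt ∈ U := by
  have hc : Continuous fun t : ℝ => j.1.pt + t • v.pt := by fun_prop
  have h0 : j.1.pt + (0 : ℝ) • v.pt ∈ U := by simpa using j.2
  simp only [Jet.pt_add_smul]
  exact hc.continuousAt.eventually (U.isOpen.mem_nhds h0)

/-- The extension by zero of a function on the jets over `U`. -/
def extendZero (F : JetOver U → ℝ) : Jet → ℝ := Function.extend Subtype.val F 0

theorem extendZero_apply (F : JetOver U → ℝ) (j : JetOver U) : extendZero F j.1 = F j :=
  Subtype.val_injective.extend_apply _ _ _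

theorem extendZero_mk (F : JetOver U → ℝ) {j : Jet} (hj : j.pt ∈ U) :
    extendZero F j = F ⟨j, hj⟩ :=
  extendZero_apply F ⟨j, hj⟩

/-- A function on all jets is, on a short line through a jet over `U`, the extension by zero of
its restriction. -/
theorem hasLineDerivAt_extendZero_iff {F : Jet → ℝ} {G : JetOver U → ℝ}
    (hFG : ∀ j : JetOver U, G j = F j.1) {j : JetOver U} {v : Jet} {d : ℝ} :
    HasLineDerivAt ℝ (extendZero G) d j.1 v ↔ HasLineDerivAt ℝ F d j.1 v := by
  refine Filter.EventuallyEq.hasDerivAt_iff ?_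
  filter_upwards [j.eventually_mem v] with t ht
  rw [extendZero_mk G ht, hFG]

theorem lineDeriv_extendZero {F : Jet → ℝ} {G : JetOver U → ℝ}
    (hFG : ∀ j : JetOver U, G j = F j.1) (j : JetOver U) (v : Jet) :
    lineDeriv ℝ (extendZero G) j.1 v = lineDeriv ℝ F j.1 v := by
  refine Filter.EventuallyEq.deriv_eq ?_
  filter_upwards [j.eventually_mem v] with t ht
  rw [extendZero_mk G ht, hFG]

variable (U) in
/-- The generators of the algebra of differential functions: smooth functions of the point below
a jet and jet coordinates. -/
def jetGenerators : Set (JetOver U → ℝ) :=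
  (Set.range fun (a : SmoothMap U ℝ) (j : JetOver U) => a.1 j.1.pt) ∪
    Set.range fun (α : Fin 3 → ℕ) (j : JetOver U) => j.1.2 α

variable (U) in
/-- The algebra of differential functions over `U`: polynomials in the jet coordinates whose
coefficients are smooth functions on `U`. -/
abbrev JetAlg : Subalgebra ℝ (JetOver U → ℝ) := Algebra.adjoin ℝ (jetGenerators U)

/-- The pullback to jets of a smooth function on `U`. -/
def pull : SmoothMap U ℝ →ₗ[ℝ] JetAlg U where
  toFun a := ⟨fun j => a.1 j.1.pt, Algebra.subset_adjoin (Or.inl ⟨a, rfl⟩)⟩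
  map_add' _ _ := rfl
  map_smul' _ _ := rfl

variable (U) in
/-- The jet coordinate `w_α`. -/
def jetCoord (α : Fin 3 → ℕ) : JetAlg U :=
  ⟨fun j => j.1.2 α, Algebra.subset_adjoin (Or.inr ⟨α, rfl⟩)⟩

theorem pull_apply (a : SmoothMap U ℝ) (j : JetOver U) : (pull a).1 j = a.1 j.1.pt := rfl

theorem jetCoord_apply (α : Fin 3 → ℕ) (j : JetOver U) : (jetCoord U α).1 j = j.1.2 α := rfl

theorem hasLineDerivAt_jetCoord (α : Fin 3 → ℕ) (j : JetOver U) (v : Jet) :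
    HasLineDerivAt ℝ (extendZero (jetCoord U α).1) (v.2 α) j.1 v := by
  rw [hasLineDerivAt_extendZero_iff (F := fun j => j.2 α) (jetCoord_apply α)]
  have h := ((hasDerivAt_id (0 : ℝ)).mul_const (v.2 α)).const_add (j.1.2 α)
  simpa [HasLineDerivAt] using h

theorem hasLineDerivAt_pull (a : SmoothMap U ℝ) (j : JetOver U) (v : Jet) :
    HasLineDerivAt ℝ (extendZero (pull a).1) (∑ i, (pd i a).1 j.1.pt * v.pt i) j.1 v := by
  rw [hasLineDerivAt_extendZero_iff (F := fun j => a.1 j.pt) (pull_apply a),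
    ← fderiv_eq_sum_pd a j.2]
  have h := (SmoothMap.differentiableAt a j.2).hasFDerivAt.hasLineDerivAt v.pt
  simpa only [HasLineDerivAt, Jet.pt_add_smul] using h

theorem hasLineDerivAt_const_extendZero (c : ℝ) (j : JetOver U) (v : Jet) :
    HasLineDerivAt ℝ (extendZero fun _ : JetOver U => c) 0 j.1 v := by
  rw [hasLineDerivAt_extendZero_iff (F := fun _ => c) fun _ => rfl]
  exact hasDerivAt_const _ _

theorem hasLineDerivAt_add {F G : JetOver U → ℝ} {j : JetOver U} {v : Jet} {d e : ℝ}
    (hF : HasLineDerivAt ℝ (extendZero F) d j.1 v) (hG : HasLineDerivAt ℝ (extendZero G) e j.1 v) :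
    HasLineDerivAt ℝ (extendZero (F + G)) (d + e) j.1 v := by
  rw [hasLineDerivAt_extendZero_iff (F := extendZero F + extendZero G) fun j => by
    simp [extendZero_apply]]
  exact HasDerivAt.add hF hG

theorem hasLineDerivAt_mul {F G : JetOver U → ℝ} {j : JetOver U} {v : Jet} {d e : ℝ}
    (hF : HasLineDerivAt ℝ (extendZero F) d j.1 v) (hG : HasLineDerivAt ℝ (extendZero G) e j.1 v) :
    HasLineDerivAt ℝ (extendZero (F * G)) (d * G j + F j * e) j.1 v := by
  rw [hasLineDerivAt_extendZero_iff (F := extendZero F * extendZero G) fun j => by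
    simp [extendZero_apply]]
  have h := HasDerivAt.mul hF hG
  simp only [zero_smul, add_zero, extendZero_apply] at h
  exact h

/-- For an arbitrary function `lineDeriv` may be the default value 0 and obey no product rule.
Differential functions are line differentiable in every direction, because the generators are and
sums and products preserve this. -/
theorem JetAlg.hasLineDerivAt (F : JetAlg U) (j : JetOver U) (v : Jet) :
    HasLineDerivAt ℝ (extendZero F.1) (lineDeriv ℝ (extendZero F.1) j.1 v) j.1 v := by
  suffices h : ∀ F ∈ JetAlg U, LineDifferentiableAt ℝ (extendZero F) j.1 v from
    (h F.1 F.2).hasLineDerivAt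
  intro F hF
  induction hF using Algebra.adjoin_induction with
  | mem F hF =>
    rcases hF with ⟨a, rfl⟩ | ⟨α, rfl⟩
    · exact (hasLineDerivAt_pull a j v).lineDifferentiableAt
    · exact (hasLineDerivAt_jetCoord α j v).lineDifferentiableAt
  | algebraMap c => exact (hasLineDerivAt_const_extendZero c j v).lineDifferentiableAt
  | add F G _ _ hF hG =>
    exact (hasLineDerivAt_add hF.hasLineDerivAt hG.hasLineDerivAt).lineDifferentiableAt
  | mul F G _ _ hF hG =>
    exact (hasLineDerivAt_mul hF.hasLineDerivAt hG.hasLineDerivAt).lineDifferentiableAt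

/-- The derivation of the algebra of differential functions given by a vector field on the jet
space whose components are differential functions. -/
def jetDerivation (A : Fin 3 → JetAlg U) (B : (Fin 3 → ℕ) → JetAlg U) :
    Derivation ℝ (JetAlg U) (JetAlg U) :=
  let v : JetOver U → Jet := fun j => (fun i => (A i).1 j, fun α => (B α).1 j)
  -- Differentiating along a field whose components are differential functions stays in the algebra:
  -- this is checked on generators and carried through sums and the product rule.
  have mem : ∀ F ∈ JetAlg U, (fun j : JetOver U => lineDeriv ℝ (extendZero F) j.1 (v j)) ∈
      JetAlg U := by
    intro F hF
    induction hF using Algebra.adjoin_induction with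
    | mem F hF =>
      rcases hF with ⟨a, rfl⟩ | ⟨α, rfl⟩
      · have h : (fun j : JetOver U => lineDeriv ℝ (extendZero (pull a).1) j.1 (v j)) =
            (∑ i : Fin 3, pull (pd i.castSucc a) * A i + pull (pd 3 a) * B 0 : JetAlg U).1 := by
          funext j
          rw [(hasLineDerivAt_pull a j (v j)).lineDeriv, Fin.sum_univ_castSucc]
          simp only [Jet.pt_castSucc]
          simp [v, pull_apply, Jet.pt, Finset.sum_apply]
        exact h ▸ Subtype.property _
      · have h : (fun j : JetOver U => lineDeriv ℝ (extendZero (jetCoord U α).1) j.1 (v j)) =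
            (B α).1 := by
          funext j
          rw [(hasLineDerivAt_jetCoord α j (v j)).lineDeriv]
        exact h ▸ (B α).2
    | algebraMap c =>
      have h : (fun j : JetOver U => lineDeriv ℝ
          (extendZero (algebraMap ℝ (JetOver U → ℝ) c)) j.1 (v j)) = 0 := by
        funext j
        exact (hasLineDerivAt_const_extendZero c j (v j)).lineDeriv
      exact h ▸ zero_mem _
    | add F G hF hG ihF ihG =>
      convert add_mem ihF ihG using 1
      funext j
      exact (hasLineDerivAt_add (JetAlg.hasLineDerivAt ⟨F, hF⟩ j (v j))
        (JetAlg.hasLineDerivAt ⟨G, hG⟩ j (v j))).lineDeriv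
    | mul F G hF hG ihF ihG =>
      convert add_mem (mul_mem ihF hG) (mul_mem hF ihG) using 1
      funext j
      exact (hasLineDerivAt_mul (JetAlg.hasLineDerivAt ⟨F, hF⟩ j (v j))
        (JetAlg.hasLineDerivAt ⟨G, hG⟩ j (v j))).lineDeriv
  Derivation.mk'
    { toFun := fun F => ⟨fun j => lineDeriv ℝ (extendZero F.1) j.1 (v j), mem F.1 F.2⟩
      map_add' := fun F G => Subtype.ext <| funext fun j =>
        (hasLineDerivAt_add (JetAlg.hasLineDerivAt F j (v j))
          (JetAlg.hasLineDerivAt G j (v j))).lineDeriv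
      map_smul' := fun c F => Subtype.ext <| funext fun j => by
        have h := (hasLineDerivAt_mul (hasLineDerivAt_const_extendZero c j (v j))
          (JetAlg.hasLineDerivAt F j (v j))).lineDeriv
        rw [zero_mul, zero_add] at h
        exact h }
    fun F G => Subtype.ext <| funext fun j => by
      refine (hasLineDerivAt_mul (JetAlg.hasLineDerivAt F j (v j))
          (JetAlg.hasLineDerivAt G j (v j))).lineDeriv.trans ?_
      simp only [LinearMap.coe_mk, AddHom.coe_mk, smul_eq_mul, AddMemClass.coe_add,
        MulMemClass.coe_mul, Pi.add_apply, Pi.mul_apply]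
      ring

theorem jetDerivation_apply (A : Fin 3 → JetAlg U) (B : (Fin 3 → ℕ) → JetAlg U) (F : JetAlg U)
    (j : JetOver U) : (jetDerivation A B F).1 j =
      lineDeriv ℝ (extendZero F.1) j.1 (fun i => (A i).1 j, fun α => (B α).1 j) := rfl

theorem jetDerivation_jetCoord (A : Fin 3 → JetAlg U) (B : (Fin 3 → ℕ) → JetAlg U)
    (α : Fin 3 → ℕ) : jetDerivation A B (jetCoord U α) = B α :=
  Subtype.ext <| funext fun j => (hasLineDerivAt_jetCoord α j _).lineDeriv

/-- This is the chain rule; `B 0` appears because the coordinate w of the base point is the jet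
coordinate of multi-index 0. -/
theorem jetDerivation_pull (A : Fin 3 → JetAlg U) (B : (Fin 3 → ℕ) → JetAlg U)
    (a : SmoothMap U ℝ) : jetDerivation A B (pull a) =
      ∑ i : Fin 3, pull (pd i.castSucc a) * A i + pull (pd 3 a) * B 0 := by
  refine Subtype.ext <| funext fun j => ?_
  rw [jetDerivation_apply, (hasLineDerivAt_pull a j _).lineDeriv, Fin.sum_univ_castSucc]
  simp only [Jet.pt_castSucc]
  simp [pull_apply, Jet.pt, Finset.sum_apply]

/-- The Leibniz rule propagates agreement from the generators; commutator identities below are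
proved by comparing two derivations in this way. -/
theorem JetAlg.derivation_ext {D D' : Derivation ℝ (JetAlg U) (JetAlg U)}
    (hp : ∀ a, D (pull a) = D' (pull a)) (hc : ∀ α, D (jetCoord U α) = D' (jetCoord U α)) :
    D = D' := by
  refine Derivation.ext fun F => ?_
  obtain ⟨F, hF⟩ := F
  induction hF using Algebra.adjoin_induction with
  | mem F hF =>
    rcases hF with ⟨a, rfl⟩ | ⟨α, rfl⟩
    · exact hp a
    · exact hc α
  | algebraMap c =>
    exact (D.map_algebraMap c).trans (D'.map_algebraMap c).symm
  | add F G hF hG ihF ihG =>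
    have h : (⟨F + G, add_mem hF hG⟩ : JetAlg U) = ⟨F, hF⟩ + ⟨G, hG⟩ := rfl
    rw [h, map_add, map_add, ihF, ihG]
  | mul F G hF hG ihF ihG =>
    have h : (⟨F * G, mul_mem hF hG⟩ : JetAlg U) = ⟨F, hF⟩ * ⟨G, hG⟩ := rfl
    rw [h, D.leibniz, D'.leibniz, ihF, ihG]

variable (U) in
/-- The total derivative `D_i` on differential functions. -/
def totalD (i : Fin 3) : Derivation ℝ (JetAlg U) (JetAlg U) :=
  jetDerivation (fun k => algebraMap ℝ _ (Pi.single (M := fun _ => ℝ) i 1 k))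
    fun α => jetCoord U (α + Pi.single i 1)

variable (U) in
/-- The derivation along a constant vector tangent to the fibres of the jet space. -/
def fiberD (v : (Fin 3 → ℕ) → ℝ) : Derivation ℝ (JetAlg U) (JetAlg U) :=
  jetDerivation 0 fun α => algebraMap ℝ _ (v α)

theorem totalD_jetCoord (i : Fin 3) (α : Fin 3 → ℕ) :
    totalD U i (jetCoord U α) = jetCoord U (α + Pi.single i 1) :=
  jetDerivation_jetCoord _ _ _

theorem totalD_pull (i : Fin 3) (a : SmoothMap U ℝ) :
    totalD U i (pull a) = pull (pd i.castSucc a) + pull (pd 3 a) * jetCoord U (Pi.single i 1) := by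
  rw [totalD, jetDerivation_pull, zero_add, Finset.sum_eq_single i]
  · simp
  · intro k _ hk
    simp [Pi.single_eq_of_ne hk]
  · simp

theorem fiberD_jetCoord (v : (Fin 3 → ℕ) → ℝ) (α : Fin 3 → ℕ) :
    fiberD U v (jetCoord U α) = algebraMap ℝ _ (v α) :=
  jetDerivation_jetCoord _ _ _

theorem fiberD_pull (v : (Fin 3 → ℕ) → ℝ) (a : SmoothMap U ℝ) :
    fiberD U v (pull a) = v 0 • pull (pd 3 a) := by
  rw [fiberD, jetDerivation_pull]
  simp [Algebra.smul_def, mul_comm]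

theorem totalD_comm (i k : Fin 3) (F : JetAlg U) :
    totalD U i (totalD U k F) = totalD U k (totalD U i F) := by
  have h : ⁅totalD U i, totalD U k⁆ = 0 := by
    refine JetAlg.derivation_ext (fun a => ?_) fun α => ?_
    · simp only [Derivation.commutator_apply, totalD_pull, map_add, Derivation.leibniz,
        totalD_jetCoord, Derivation.coe_zero, Pi.zero_apply, smul_eq_mul,
        pd_comm 3 i.castSucc, pd_comm k.castSucc i.castSucc, pd_comm 3 k.castSucc,
        add_comm (Pi.single k 1 : Fin 3 → ℕ)]
      ring
    · simp only [Derivation.commutator_apply, totalD_jetCoord, Derivation.coe_zero, Pi.zero_apply,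
        add_right_comm α, sub_self]
  have h2 := DFunLike.congr_fun h F
  rwa [Derivation.commutator_apply, Derivation.coe_zero, Pi.zero_apply, sub_eq_zero] at h2

/-- The fibre derivative and the total derivative commute up to a shift of the direction. -/
theorem fiberD_totalD (v : (Fin 3 → ℕ) → ℝ) (i : Fin 3) (F : JetAlg U) :
    fiberD U v (totalD U i F) =
      totalD U i (fiberD U v F) + fiberD U (fun α => v (α + Pi.single i 1)) F := by
  -- The coefficient of ∂/∂w_α in D_i is the coordinate w_{α+e_i}; its derivative along v is the
  -- constant v(α+e_i), which is where the shift comes from.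
  have h : ⁅fiberD U v, totalD U i⁆ = fiberD U fun α => v (α + Pi.single i 1) := by
    refine JetAlg.derivation_ext (fun a => ?_) fun α => ?_
    · simp only [Derivation.commutator_apply, totalD_pull, map_add, Derivation.leibniz,
        fiberD_jetCoord, fiberD_pull, smul_eq_mul, pd_comm 3 i.castSucc, Algebra.smul_def,
        zero_add, Derivation.map_algebraMap]
      ring
    · simp only [Derivation.commutator_apply, totalD_jetCoord, fiberD_jetCoord,
        Derivation.map_algebraMap, sub_zero]
  have h2 := DFunLike.congr_fun h F
  rw [Derivation.commutator_apply] at h2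
  linear_combination h2

/-- Restricted to jets over `U`, total derivatives of differential functions are given by the
derivations `totalD`. -/
theorem totalDeriv_eq (i : Fin 3) {F : Jet → ℝ} {G : JetAlg U}
    (hFG : ∀ j : JetOver U, G.1 j = F j.1) (j : JetOver U) :
    (totalD U i G).1 j = totalDeriv i F j.1 := by
  rw [totalDeriv, ← lineDeriv_extendZero hFG]
  rfl

theorem totalDeriv_iterate_eq (i : Fin 3) (n : ℕ) {F : Jet → ℝ} {G : JetAlg U}
    (hFG : ∀ j : JetOver U, G.1 j = F j.1) (j : JetOver U) :
    ((totalD U i)^[n] G).1 j = (totalDeriv i)^[n] F j.1 := by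
  induction n generalizing F G with
  | zero => exact hFG j
  | succ n ih =>
    rw [Function.iterate_succ_apply, Function.iterate_succ_apply]
    exact ih (totalDeriv_eq i hFG)

/-- The iterated total derivative `D^α` on differential functions. -/
def totalDIter (α : Fin 3 → ℕ) (F : JetAlg U) : JetAlg U :=
  (totalD U 0)^[α 0] ((totalD U 1)^[α 1] ((totalD U 2)^[α 2] F))

/-- This transfers the prolongation formula, stated for functions on all jets, to the algebra where
the derivations can be manipulated. -/
theorem totalDerivIter_eq (α : Fin 3 → ℕ) {F : Jet → ℝ} {G : JetAlg U}
    (hFG : ∀ j : JetOver U, G.1 j = F j.1) (j : JetOver U) :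
    (totalDIter α G).1 j = totalDerivIter α F j.1 :=
  totalDeriv_iterate_eq 0 _ (totalDeriv_iterate_eq 1 _ (totalDeriv_iterate_eq 2 _ hFG)) j

end

section

variable {U : Opens (Fin 4 → ℝ)}

/-! ### Prolongation in the algebra of differential functions -/

/-- The `i`-th component of a vector field on `U`. -/
def VF.comp (V : VF U) (i : Fin 4) : SmoothMap U ℝ :=
  ⟨fun p => V.1 p i, contDiffOn_pi.1 V.2.1 i, fun p hp => congrFun (V.2.2 p hp) i⟩

/-- The jet coordinate with multi-index `(a, b, c)`. -/
abbrev jw (U : Opens (Fin 4 → ℝ)) (a b c : ℕ) : JetAlg U := jetCoord U ![a, b, c]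

theorem vec_add_single_zero (a b c : ℕ) :
    (![a, b, c] + Pi.single 0 1 : Fin 3 → ℕ) = ![a + 1, b, c] := by
  funext i; fin_cases i <;> simp

theorem vec_add_single_one (a b c : ℕ) :
    (![a, b, c] + Pi.single 1 1 : Fin 3 → ℕ) = ![a, b + 1, c] := by
  funext i; fin_cases i <;> simp

theorem vec_add_single_two (a b c : ℕ) :
    (![a, b, c] + Pi.single 2 1 : Fin 3 → ℕ) = ![a, b, c + 1] := by
  funext i; fin_cases i <;> simp

theorem single_zero_eq : (Pi.single 0 1 : Fin 3 → ℕ) = ![1, 0, 0] := by decide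
theorem single_one_eq : (Pi.single 1 1 : Fin 3 → ℕ) = ![0, 1, 0] := by decide
theorem single_two_eq : (Pi.single 2 1 : Fin 3 → ℕ) = ![0, 0, 1] := by decide

theorem totalD_zero_jw (a b c : ℕ) : totalD U 0 (jw U a b c) = jw U (a + 1) b c := by
  rw [totalD_jetCoord, vec_add_single_zero]

theorem totalD_one_jw (a b c : ℕ) : totalD U 1 (jw U a b c) = jw U a (b + 1) c := by
  rw [totalD_jetCoord, vec_add_single_one]

theorem totalD_two_jw (a b c : ℕ) : totalD U 2 (jw U a b c) = jw U a b (c + 1) := by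
  rw [totalD_jetCoord, vec_add_single_two]

/-- The characteristic of a vector field as a differential function. -/
def charAlg (V : VF U) : JetAlg U :=
  pull (V.comp 3) - pull (V.comp 0) * jw U 1 0 0 - pull (V.comp 1) * jw U 0 1 0
    - pull (V.comp 2) * jw U 0 0 1

theorem charAlg_apply (V : VF U) (j : JetOver U) : (charAlg V).1 j = characteristic V.1 j.1 := by
  have h : (charAlg V).1 j = V.1 j.1.pt 3 - V.1 j.1.pt 0 * j.1.2 ![1, 0, 0]
    - V.1 j.1.pt 1 * j.1.2 ![0, 1, 0] - V.1 j.1.pt 2 * j.1.2 ![0, 0, 1] := rfl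
  rw [h, characteristic, Fin.sum_univ_three, single_zero_eq, single_one_eq, single_two_eq]
  simp only [Fin.castSucc_zero, Fin.castSucc_one, show Fin.castSucc (2 : Fin 3) = 2 from rfl]
  ring

/-- The component of the prolongation of a vector field along the jet coordinate `w_{(a, b, c)}`. -/
def prolongAlg (V : VF U) (a b c : ℕ) : JetAlg U :=
  totalDIter ![a, b, c] (charAlg V) + (pull (V.comp 0) * jw U (a + 1) b c
    + pull (V.comp 1) * jw U a (b + 1) c + pull (V.comp 2) * jw U a b (c + 1))

theorem prolongAlg_apply (V : VF U) (a b c : ℕ) (j : JetOver U) :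
    (prolongAlg V a b c).1 j = (prolongation V.1 j.1).2 ![a, b, c] := by
  have h : (prolongation V.1 j.1).2 ![a, b, c] = totalDerivIter ![a, b, c]
      (characteristic V.1) j.1 + ∑ i : Fin 3, V.1 j.1.pt i.castSucc *
        j.1.2 (![a, b, c] + Pi.single i 1) := rfl
  rw [h, Fin.sum_univ_three, vec_add_single_zero, vec_add_single_one,
    vec_add_single_two, ← totalDerivIter_eq ![a, b, c] (charAlg_apply V)]
  rfl

variable (U) in
/-- The left-hand side of the equation as a differential function. -/
def kpAlg : JetAlg U :=
  jw U 4 1 0 + 6 * jw U 2 0 0 * jw U 1 1 0 + 4 * jw U 1 0 0 * jw U 2 1 0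
    + 2 * jw U 3 0 0 * jw U 0 1 0 - 2 * jw U 2 0 1 + jw U 0 3 0

theorem kpAlg_apply (j : JetOver U) : (kpAlg U).1 j = higherKP j.1 := rfl

/-- The prolongation of a vector field, applied to the left-hand side of the equation. -/
def kpVariation (V : VF U) : JetAlg U :=
  prolongAlg V 4 1 0 + 6 * (prolongAlg V 2 0 0 * jw U 1 1 0 + jw U 2 0 0 * prolongAlg V 1 1 0)
    + 4 * (prolongAlg V 1 0 0 * jw U 2 1 0 + jw U 1 0 0 * prolongAlg V 2 1 0)
    + 2 * (prolongAlg V 3 0 0 * jw U 0 1 0 + jw U 3 0 0 * prolongAlg V 0 1 0)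
    - 2 * prolongAlg V 2 0 1 + prolongAlg V 0 3 0

theorem hasLineDerivAt_coord (α : Fin 3 → ℕ) (j v : Jet) :
    HasDerivAt (fun t : ℝ => (j + t • v).2 α) (v.2 α) 0 := by
  have h := ((hasDerivAt_id (0 : ℝ)).mul_const (v.2 α)).const_add (j.2 α)
  simpa using h

theorem lineDeriv_higherKP (j v : Jet) : lineDeriv ℝ higherKP j v =
    v.2 ![4, 1, 0] + 6 * (v.2 ![2, 0, 0] * j.2 ![1, 1, 0] + j.2 ![2, 0, 0] * v.2 ![1, 1, 0])
    + 4 * (v.2 ![1, 0, 0] * j.2 ![2, 1, 0] + j.2 ![1, 0, 0] * v.2 ![2, 1, 0])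
    + 2 * (v.2 ![3, 0, 0] * j.2 ![0, 1, 0] + j.2 ![3, 0, 0] * v.2 ![0, 1, 0])
    - 2 * v.2 ![2, 0, 1] + v.2 ![0, 3, 0] := by
  have c := fun α => hasLineDerivAt_coord α j v
  have h := (((((c ![4, 1, 0]).add (((c ![2, 0, 0]).const_mul 6).mul (c ![1, 1, 0]))).add
    (((c ![1, 0, 0]).const_mul 4).mul (c ![2, 1, 0]))).add
    (((c ![3, 0, 0]).const_mul 2).mul (c ![0, 1, 0]))).sub ((c ![2, 0, 1]).const_mul 2)).add
    (c ![0, 3, 0])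
  refine (HasDerivAt.deriv h).trans ?_
  simp only [zero_smul, add_zero]
  ring

/-- Δ is a polynomial in finitely many jet coordinates, so its line derivative along the
prolongation is the formal variation. The condition becomes one about a single element of `JetAlg`.
-/
theorem isLiePointSymmetry_iff_kpVariation (V : VF U) :
    IsLiePointSymmetry higherKP V ↔
      ∀ j : JetOver U, higherKP j.1 = 0 → (kpVariation V).1 j = 0 := by
  have h : ∀ j : JetOver U,
      (kpVariation V).1 j = lineDeriv ℝ higherKP j.1 (prolongation V.1 j.1) := by
    intro j
    rw [lineDeriv_higherKP]
    simp only [← prolongAlg_apply]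
    rfl
  simp only [h, IsLiePointSymmetry, Subtype.forall]

/-- The determining equations of the symmetries. -/
structure DeterminingEquations (V : VF U) : Prop where
  xi_y : pd 1 (V.comp 0) = 0
  xi_w : pd 3 (V.comp 0) = 0
  eta_x : pd 0 (V.comp 1) = 0
  eta_w : pd 3 (V.comp 1) = 0
  tau_x : pd 0 (V.comp 2) = 0
  tau_y : pd 1 (V.comp 2) = 0
  tau_w : pd 3 (V.comp 2) = 0
  eta_y : pd 1 (V.comp 1) = (2 : ℝ) • pd 0 (V.comp 0)
  tau_z : pd 2 (V.comp 2) = (4 : ℝ) • pd 0 (V.comp 0)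
  phi_w : pd 3 (V.comp 3) = -pd 0 (V.comp 0)
  phi_x : pd 0 (V.comp 3) = -((1 / 2 : ℝ) • pd 2 (V.comp 1))
  phi_y : pd 1 (V.comp 3) = -pd 2 (V.comp 0)

theorem totalD_zero_pull (a : SmoothMap U ℝ) :
    totalD U 0 (pull a) = pull (pd 0 a) + pull (pd 3 a) * jw U 1 0 0 := by
  rw [totalD_pull, single_zero_eq]; rfl

theorem totalD_one_pull (a : SmoothMap U ℝ) :
    totalD U 1 (pull a) = pull (pd 1 a) + pull (pd 3 a) * jw U 0 1 0 := by
  rw [totalD_pull, single_one_eq]; rfl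

theorem totalD_two_pull (a : SmoothMap U ℝ) :
    totalD U 2 (pull a) = pull (pd 2 a) + pull (pd 3 a) * jw U 0 0 1 := by
  rw [totalD_pull, single_two_eq]; rfl

/-! ### Sufficiency of the determining equations -/

namespace DeterminingEquations

variable {V : VF U}

/-- 4 ξ_xx = ∂_x τ_z = ∂_z τ_x = 0. -/
theorem xi_xx (h : DeterminingEquations V) : pd 0 (pd 0 (V.comp 0)) = 0 := by
  have h4 : (4 : ℝ) • pd 0 (pd 0 (V.comp 0)) = 0 := by
    rw [← map_smul, ← h.tau_z, pd_comm, h.tau_x, map_zero]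
  simpa using h4

/-- The factor -7 is the common weight of the terms of Δ when x, y, z, w have weights 1, 2, 4, -1;
for w_yyy it is -1 - 3·2. The identity holds on all jets, not only on solutions. -/
theorem kpVariation_eq (h : DeterminingEquations V) :
    kpVariation V = -7 * pull (pd 0 (V.comp 0)) * kpAlg U := by
  set ξ := pull (V.comp 0) with hξ
  set η := pull (V.comp 1) with hη
  set τ := pull (V.comp 2) with hτ
  set φ := pull (V.comp 3) with hφ
  set α := pull (pd 0 (V.comp 0)) with hα
  -- Half of η_z is the basic symbol, so that φ_x = -δ and η_z = δ + δ; all coefficients in the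
  -- final polynomial identity are then integers.
  set δ := pull ((1 / 2 : ℝ) • pd 2 (V.comp 1)) with hδ
  set ε := pull (pd 2 (V.comp 0)) with hε
  set ζ := pull (pd 2 (pd 0 (V.comp 0))) with hζ
  set ψ := pull (pd 2 (V.comp 3)) with hψ
  have αx : totalD U 0 α = 0 := by simp [hα, totalD_zero_pull, h.xi_xx, pd_comm 3 0, h.xi_w]
  have αy : totalD U 1 α = 0 := by
    simp [hα, totalD_one_pull, pd_comm 1 0, pd_comm 3 0, h.xi_w, h.xi_y]
  have αz : totalD U 2 α = ζ := by simp [hα, hζ, totalD_two_pull, pd_comm 3 0, h.xi_w]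
  have ξx : totalD U 0 ξ = α := by simp [hξ, hα, totalD_zero_pull, h.xi_w]
  have ξy : totalD U 1 ξ = 0 := by simp [hξ, totalD_one_pull, h.xi_w, h.xi_y]
  have ξz : totalD U 2 ξ = ε := by simp [hξ, hε, totalD_two_pull, h.xi_w]
  have ηx : totalD U 0 η = 0 := by simp [hη, totalD_zero_pull, h.eta_w, h.eta_x]
  have ηy : totalD U 1 η = α + α := by
    simp [hη, hα, totalD_one_pull, h.eta_w, h.eta_y, two_smul]
  have ηz : totalD U 2 η = δ + δ := by
    rw [hη, hδ, totalD_two_pull, h.eta_w, ← map_add, ← add_smul]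
    norm_num
  have τx : totalD U 0 τ = 0 := by simp [hτ, totalD_zero_pull, h.tau_w, h.tau_x]
  have τy : totalD U 1 τ = 0 := by simp [hτ, totalD_one_pull, h.tau_w, h.tau_y]
  have τz : totalD U 2 τ = α + α + α + α := by
    rw [hτ, hα, totalD_two_pull, h.tau_w, h.tau_z, map_zero, zero_mul, add_zero, map_smul,
      show (4 : ℝ) = 1 + 1 + 1 + 1 by norm_num]
    simp only [add_smul, one_smul]
  have εx : totalD U 0 ε = ζ := by rw [← ξz, totalD_comm, ξx, αz]
  have εy : totalD U 1 ε = 0 := by rw [← ξz, totalD_comm, ξy, map_zero]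
  have δ_eq : δ = (1 / 2 : ℝ) • totalD U 2 η := by
    rw [ηz, ← two_smul ℝ, smul_smul]
    norm_num
  have δx : totalD U 0 δ = 0 := by
    rw [δ_eq, Derivation.map_smul, totalD_comm, ηx, map_zero, smul_zero]
  have φx : totalD U 0 φ = -δ - α * jw U 1 0 0 := by
    rw [hφ, hδ, hα, totalD_zero_pull, h.phi_w, h.phi_x, map_neg, map_neg]
    ring
  have φy : totalD U 1 φ = -ε - α * jw U 0 1 0 := by
    rw [hφ, hε, hα, totalD_one_pull, h.phi_w, h.phi_y, map_neg, map_neg]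
    ring
  have φz : totalD U 2 φ = ψ - α * jw U 0 0 1 := by
    rw [hφ, hψ, hα, totalD_two_pull, h.phi_w, map_neg]
    ring
  have ψx : totalD U 0 ψ = -totalD U 2 δ - ζ * jw U 1 0 0 := by
    -- φ_z is recovered from D_z φ, so that its x-derivative follows from D_x φ by commuting total
    -- derivatives.
    have h2 : ψ = totalD U 2 φ + α * jw U 0 0 1 := by rw [φz]; ring
    rw [h2, map_add, totalD_comm, φx, map_sub, map_neg, Derivation.leibniz, Derivation.leibniz,
      totalD_two_jw, totalD_zero_jw, αx, αz]
    simp only [smul_eq_mul]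
    ring
  have δzx : totalD U 0 (totalD U 2 δ) = 0 := by rw [totalD_comm, δx, map_zero]
  have ζx : totalD U 0 ζ = 0 := by rw [← αz, totalD_comm, αx, map_zero]
  -- The rules collected above cover every total derivative that arises, so the expansion ends in a
  -- polynomial identity in finitely many symbols.
  simp only [kpVariation, kpAlg, prolongAlg, totalDIter, charAlg, Matrix.cons_val_zero,
    Matrix.cons_val_one, Matrix.cons_val, Function.iterate_succ_apply,
    Function.iterate_zero_apply, map_add, map_sub, map_neg, Derivation.leibniz,
    smul_eq_mul, totalD_zero_jw, totalD_one_jw, totalD_two_jw, αx, αy, ξx, ξy, ξz, ηx, ηy,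
    ηz, τx, τy, τz, εx, εy, δx, φx, φy, φz, ψx, δzx, ζx, ← hξ, ← hη, ← hτ, ← hφ, mul_zero,
    add_zero, zero_add, zero_sub, neg_zero, Nat.reduceAdd]
  ring

theorem isLiePointSymmetry (h : DeterminingEquations V) : IsLiePointSymmetry higherKP V := by
  rw [isLiePointSymmetry_iff_kpVariation]
  intro j hj
  have h2 : (kpVariation V).1 j = (-7 * pull (pd 0 (V.comp 0)) : JetAlg U).1 j * (kpAlg U).1 j :=
    congrFun (congrArg Subtype.val h.kpVariation_eq) j
  rw [h2, kpAlg_apply, hj, mul_zero]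

end DeterminingEquations

end

section

variable {U : Opens (Fin 4 → ℝ)}

/-! ### Fibre derivatives of the prolongation -/

variable (U) in
/-- The derivation `∂/∂w_{(a, b, c)}` on differential functions. -/
def jetD (a b c : ℕ) : Derivation ℝ (JetAlg U) (JetAlg U) := fiberD U (Pi.single ![a, b, c] 1)

theorem fiberD_add_smul (v v' : (Fin 3 → ℕ) → ℝ) (r : ℝ) (F : JetAlg U) :
    fiberD U (v + r • v') F = fiberD U v F + r • fiberD U v' F := by
  have h : fiberD U (v + r • v') = fiberD U v + r • fiberD U v' := by
    refine JetAlg.derivation_ext (fun a => ?_) fun α => ?_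
    · simp [fiberD_pull, add_smul, mul_smul]
    · simp [fiberD_jetCoord, Algebra.smul_def]
  rw [h]
  rfl

theorem fiberD_zero (F : JetAlg U) : fiberD U 0 F = 0 := by
  have h := fiberD_add_smul 0 0 1 F
  simpa using h

theorem vec_eq_iff {a b c a' b' c' : ℕ} :
    (![a, b, c] : Fin 3 → ℕ) = ![a', b', c'] ↔ a = a' ∧ b = b' ∧ c = c' := by
  simp

theorem single_comp_add {β γ δ : Fin 3 → ℕ} (h : γ + δ = β) :
    (fun α => (Pi.single β 1 : (Fin 3 → ℕ) → ℝ) (α + δ)) = Pi.single γ 1 := by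
  funext α
  subst h
  simp only [Pi.single_apply, add_left_inj]

/-- No multi-index α satisfies α + δ = β when β_i < δ_i. Hence ∂/∂w_β commutes with D_i as soon as
β_i = 0. -/
theorem single_comp_add_of_lt {β δ : Fin 3 → ℕ} {i : Fin 3} (h : β i < δ i) :
    (fun α => (Pi.single β 1 : (Fin 3 → ℕ) → ℝ) (α + δ)) = 0 := by
  funext α
  refine Pi.single_eq_of_ne (fun h2 => ?_) _
  rw [← h2, Pi.add_apply] at h
  omega

@[simp] theorem derivation_ofNat (D : Derivation ℝ (JetAlg U) (JetAlg U)) (n : ℕ) [n.AtLeastTwo] :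
    D (ofNat(n) : JetAlg U) = 0 := by
  rw [← Nat.cast_ofNat]
  exact D.map_natCast n

-- Together with the variants below, this moves fibre derivatives inward past total derivatives
-- until they reach the characteristic, lowering the multi-index on the way.
@[simp] theorem jetD_succ_totalD_zero (a b c : ℕ) (F : JetAlg U) :
    jetD U (a + 1) b c (totalD U 0 F) = totalD U 0 (jetD U (a + 1) b c F) + jetD U a b c F := by
  rw [jetD, fiberD_totalD, single_comp_add (vec_add_single_zero a b c)]; rfl

@[simp] theorem jetD_succ_totalD_one (a b c : ℕ) (F : JetAlg U) :
    jetD U a (b + 1) c (totalD U 1 F) = totalD U 1 (jetD U a (b + 1) c F) + jetD U a b c F := by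
  rw [jetD, fiberD_totalD, single_comp_add (vec_add_single_one a b c)]; rfl

@[simp] theorem jetD_succ_totalD_two (a b c : ℕ) (F : JetAlg U) :
    jetD U a b (c + 1) (totalD U 2 F) = totalD U 2 (jetD U a b (c + 1) F) + jetD U a b c F := by
  rw [jetD, fiberD_totalD, single_comp_add (vec_add_single_two a b c)]; rfl

@[simp] theorem jetD_zero_totalD_zero (b c : ℕ) (F : JetAlg U) :
    jetD U 0 b c (totalD U 0 F) = totalD U 0 (jetD U 0 b c F) := by
  rw [jetD, fiberD_totalD, single_comp_add_of_lt (i := 0) (by simp), fiberD_zero, add_zero]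

@[simp] theorem jetD_zero_totalD_one (a c : ℕ) (F : JetAlg U) :
    jetD U a 0 c (totalD U 1 F) = totalD U 1 (jetD U a 0 c F) := by
  rw [jetD, fiberD_totalD, single_comp_add_of_lt (i := 1) (by simp), fiberD_zero, add_zero]

@[simp] theorem jetD_zero_totalD_two (a b : ℕ) (F : JetAlg U) :
    jetD U a b 0 (totalD U 2 F) = totalD U 2 (jetD U a b 0 F) := by
  rw [jetD, fiberD_totalD, single_comp_add_of_lt (i := 2) (by simp), fiberD_zero, add_zero]

@[simp] theorem jetD_jw (a b c a' b' c' : ℕ) :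
    jetD U a b c (jw U a' b' c') = if a' = a ∧ b' = b ∧ c' = c then 1 else 0 := by
  rw [jetD, fiberD_jetCoord, Pi.single_apply]
  simp only [vec_eq_iff]
  split_ifs <;> simp

@[simp] theorem jetD_pull_of_pos {a b c : ℕ} (h : 0 < a + b + c) (f : SmoothMap U ℝ) :
    jetD U a b c (pull f) = 0 := by
  have h0 : (0 : Fin 3 → ℕ) ≠ ![a, b, c] := fun h2 => by
    have h3 := congrFun h2
    have := h3 0; have := h3 1; have := h3 2
    simp at *
    omega
  rw [jetD, fiberD_pull, Pi.single_eq_of_ne h0, zero_smul]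

@[simp] theorem jetD_zero_pull (f : SmoothMap U ℝ) : jetD U 0 0 0 (pull f) = pull (pd 3 f) := by
  have h0 : (0 : Fin 3 → ℕ) = ![0, 0, 0] := by decide
  rw [jetD, fiberD_pull, h0, Pi.single_eq_same, one_smul]

@[simp] theorem jetD_one_zero_zero_charAlg (V : VF U) :
    jetD U 1 0 0 (charAlg V) = -pull (V.comp 0) := by
  simp [charAlg, jetD_jw, jetD_pull_of_pos]

@[simp] theorem jetD_zero_one_zero_charAlg (V : VF U) :
    jetD U 0 1 0 (charAlg V) = -pull (V.comp 1) := by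
  simp [charAlg, jetD_jw, jetD_pull_of_pos]

@[simp] theorem jetD_zero_zero_one_charAlg (V : VF U) :
    jetD U 0 0 1 (charAlg V) = -pull (V.comp 2) := by
  simp [charAlg, jetD_jw, jetD_pull_of_pos]

-- The characteristic contains no jet coordinate of order above one; this kills most terms in the
-- coefficients computed below.
@[simp] theorem jetD_charAlg_of_two_le (V : VF U) {a b c : ℕ} (h : 2 ≤ a + b + c) :
    jetD U a b c (charAlg V) = 0 := by
  have h1 : ¬ (1 = a ∧ 0 = b ∧ 0 = c) := by omega
  have h2 : ¬ (0 = a ∧ 1 = b ∧ 0 = c) := by omega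
  have h3 : ¬ (0 = a ∧ 0 = b ∧ 1 = c) := by omega
  simp [charAlg, jetD_jw, jetD_pull_of_pos (show 0 < a + b + c by omega), h1, h2, h3]


/-! ### Coefficients of the variation in the jet coordinates of order three to five -/

theorem jetD_five_zero_zero_kpVariation (V : VF U) :
    jetD U 5 0 0 (kpVariation V) =
    -totalD U 1 (pull (V.comp 0)) := by
  -- Only the component along w_xxxxy contributes: one way of distributing ∂/∂w_xxxxx over D_x^4 D_y
  -- leaves D_y applied to ∂Q/∂w_x = -ξ.
  simp [kpVariation, prolongAlg, totalDIter]

theorem jetD_three_two_zero_kpVariation (V : VF U) :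
    jetD U 3 2 0 (kpVariation V) =
    -4 * totalD U 0 (pull (V.comp 1)) := by
  simp [kpVariation, prolongAlg, totalDIter]
  ring

theorem jetD_three_one_one_kpVariation (V : VF U) :
    jetD U 3 1 1 (kpVariation V) =
    -4 * totalD U 0 (pull (V.comp 2)) := by
  simp [kpVariation, prolongAlg, totalDIter]
  ring

theorem jetD_four_zero_one_kpVariation (V : VF U) :
    jetD U 4 0 1 (kpVariation V) =
    -totalD U 1 (pull (V.comp 2)) := by
  simp [kpVariation, prolongAlg, totalDIter]

/-- This coefficient is the correction term: w_xxxxy is the direction used to bring a line back into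
Δ = 0. -/
theorem jetD_four_one_zero_kpVariation (V : VF U) :
    jetD U 4 1 0 (kpVariation V) =
    jetD U 0 0 0 (charAlg V) - 4 * totalD U 0 (pull (V.comp 0)) - totalD U 1 (pull (V.comp 1)) := by
  simp [kpVariation, prolongAlg, totalDIter]
  ring

theorem jetD_four_zero_zero_kpVariation (V : VF U) :
    jetD U 4 0 0 (kpVariation V) =
    totalD U 1 (jetD U 0 0 0 (charAlg V)) - 4 * totalD U 0 (totalD U 1 (pull (V.comp 0))) := by
  simp [kpVariation, prolongAlg, totalDIter]
  ring

theorem jetD_three_one_zero_kpVariation (V : VF U) :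
    jetD U 3 1 0 (kpVariation V) =
    4 * totalD U 0 (jetD U 0 0 0 (charAlg V)) - 6 * totalD U 0 (totalD U 0 (pull (V.comp 0)))
      - 4 * totalD U 0 (totalD U 1 (pull (V.comp 1))) := by
  simp [kpVariation, prolongAlg, totalDIter]
  ring

theorem jetD_zero_three_zero_kpVariation (V : VF U) :
    jetD U 0 3 0 (kpVariation V) =
    jetD U 0 0 0 (charAlg V) - 3 * totalD U 1 (pull (V.comp 1)) := by
  simp [kpVariation, prolongAlg, totalDIter]
  ring

theorem jetD_two_zero_one_kpVariation (V : VF U) :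
    jetD U 2 0 1 (kpVariation V) =
    4 * totalD U 0 (pull (V.comp 0)) + 2 * totalD U 2 (pull (V.comp 2))
      - 2 * jetD U 0 0 0 (charAlg V) - 6 * totalD U 0 (totalD U 0 (totalD U 1 (pull (V.comp 2))))
      - 4 * jw U 1 0 0 * totalD U 1 (pull (V.comp 2))
      - 6 * jw U 0 1 0 * totalD U 0 (pull (V.comp 2)) := by
  simp [kpVariation, prolongAlg, totalDIter]
  ring

theorem jetD_two_one_zero_kpVariation (V : VF U) :
    jetD U 2 1 0 (kpVariation V) =
    4 * (totalD U 0 (charAlg V) + pull (V.comp 0) * jw U 2 0 0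
      + pull (V.comp 1) * jw U 1 1 0 + pull (V.comp 2) * jw U 1 0 1)
      + 2 * totalD U 2 (pull (V.comp 1))
      + 4 * jw U 1 0 0 * (jetD U 0 0 0 (charAlg V) - 2 * totalD U 0 (pull (V.comp 0))
        - totalD U 1 (pull (V.comp 1))) - 6 * jw U 0 1 0 * totalD U 0 (pull (V.comp 1))
      + 6 * totalD U 0 (totalD U 0 (jetD U 0 0 0 (charAlg V)))
      - 4 * totalD U 0 (totalD U 0 (totalD U 0 (pull (V.comp 0))))
      - 6 * totalD U 0 (totalD U 0 (totalD U 1 (pull (V.comp 1)))) := by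
  simp [kpVariation, prolongAlg, totalDIter]
  ring

theorem jetD_three_zero_zero_kpVariation (V : VF U) :
    jetD U 3 0 0 (kpVariation V) =
    2 * (totalD U 1 (charAlg V) + pull (V.comp 0) * jw U 1 1 0
      + pull (V.comp 1) * jw U 0 2 0 + pull (V.comp 2) * jw U 0 1 1)
      + 2 * totalD U 2 (pull (V.comp 0))
      + 2 * jw U 0 1 0 * (jetD U 0 0 0 (charAlg V) - 3 * totalD U 0 (pull (V.comp 0)))
      - 4 * jw U 1 0 0 * totalD U 1 (pull (V.comp 0))
      + 4 * totalD U 0 (totalD U 1 (jetD U 0 0 0 (charAlg V)))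
      - 6 * totalD U 0 (totalD U 0 (totalD U 1 (pull (V.comp 0)))) := by
  simp [kpVariation, prolongAlg, totalDIter]
  ring

end

section

variable {U : Opens (Fin 4 → ℝ)}

/-! ### Necessity of the determining equations -/

/-- The value of a differential function at a jet. -/
def evalJet (j : JetOver U) : JetAlg U →ₐ[ℝ] ℝ :=
  (Pi.evalAlgHom ℝ (fun _ : JetOver U => ℝ) j).comp (JetAlg U).val

theorem evalJet_apply (j : JetOver U) (F : JetAlg U) : evalJet j F = F.1 j := rfl

@[simp] theorem evalJet_ofNat (j : JetOver U) (n : ℕ) [n.AtLeastTwo] :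
    evalJet j (ofNat(n) : JetAlg U) = OfNat.ofNat n :=
  map_ofNat _ n

/-- A symmetry condition on a line in a fibre of the jet space on which the equation holds. -/
theorem fiberD_kpVariation_eq_zero {V : VF U} (hV : IsLiePointSymmetry higherKP V)
    (j : JetOver U) (v : (Fin 3 → ℕ) → ℝ) (h0 : v 0 = 0)
    (hv : ∀ t : ℝ, higherKP (j.1 + t • ((0, v) : Jet)) = 0) :
    evalJet j (fiberD U v (kpVariation V)) = 0 := by
  rw [isLiePointSymmetry_iff_kpVariation] at hV
  have hpt : ∀ t : ℝ, (j.1 + t • ((0, v) : Jet)).pt ∈ U := by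
    intro t
    have h : (j.1 + t • ((0, v) : Jet)).pt = j.1.pt := by
      rw [Jet.pt_add_smul]
      funext i
      fin_cases i <;> simp [Jet.pt, h0]
    rw [h]
    exact j.2
  -- The whole line consists of solution jets over the same base point, so the variation is
  -- identically zero on it and has zero derivative.
  have h1 : (fun t : ℝ => extendZero (kpVariation V).1 (j.1 + t • ((0, v) : Jet))) =
      fun _ => 0 := by
    funext t
    rw [extendZero_mk _ (hpt t)]
    exact hV _ (hv t)
  have h2 : evalJet j (fiberD U v (kpVariation V)) =
      deriv (fun t : ℝ => extendZero (kpVariation V).1 (j.1 + t • ((0, v) : Jet))) 0 := rfl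
  rw [h2, h1, deriv_const]

/-- The jet at `p` of an affine function with partial derivatives `b` and `c` along `x` and `y`. -/
def affineJet (p : Fin 4 → ℝ) (b c : ℝ) : Jet :=
  (fun i => p i.castSucc, Function.update (Function.update (Function.update 0 0 (p 3))
    ![1, 0, 0] b) ![0, 1, 0] c)

theorem affineJet_pt (p : Fin 4 → ℝ) (b c : ℝ) : (affineJet p b c).pt = p := by
  have h0 : (0 : Fin 3 → ℕ) ≠ ![1, 0, 0] := by decide
  have h1 : (0 : Fin 3 → ℕ) ≠ ![0, 1, 0] := by decide
  funext i
  fin_cases i <;> simp [Jet.pt, affineJet, h0, h1]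

/-- The jet `affineJet p b c` at a point `p` of `U`. -/
def affineJetOver (p : U) (b c : ℝ) : JetOver U :=
  ⟨affineJet p.1 b c, by rw [affineJet_pt]; exact p.2⟩

variable (p : U) (b c : ℝ)

theorem evalJet_affine_pull (f : SmoothMap U ℝ) :
    evalJet (affineJetOver p b c) (pull f) = f.1 p := by
  rw [evalJet_apply, pull_apply]
  exact congrArg f.1 (affineJet_pt p.1 b c)

theorem evalJet_affine_jw (k l m : ℕ) (h : 0 < k + l + m) :
    evalJet (affineJetOver p b c) (jw U k l m) =
      if k = 0 ∧ l = 1 ∧ m = 0 then c else if k = 1 ∧ l = 0 ∧ m = 0 then b else 0 := by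
  have h0 : ![k, l, m] ≠ (0 : Fin 3 → ℕ) := by
    rw [show (0 : Fin 3 → ℕ) = ![0, 0, 0] by decide, Ne, vec_eq_iff]
    omega
  rw [evalJet_apply, jetCoord_apply]
  simp only [affineJetOver, affineJet, Function.update_apply, vec_eq_iff, h0, if_false,
    Pi.zero_apply]

/-- The symmetry condition, differentiated at the jet of an affine function along a direction
`∂/∂w_{(k, l, m)} + r ∂/∂w_{xxxxy}` tangent to the equation. -/
theorem jetD_kpVariation_eq_zero {V : VF U} (hV : IsLiePointSymmetry higherKP V)
    (k l m : ℕ) (r : ℝ) (h3 : 3 ≤ k + l + m)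
    (hr : (if 4 = k ∧ 1 = l ∧ 0 = m then 1 else 0) + r
      + 4 * b * (if 2 = k ∧ 1 = l ∧ 0 = m then 1 else 0)
      + 2 * c * (if 3 = k ∧ 0 = l ∧ 0 = m then 1 else 0)
      - 2 * (if 2 = k ∧ 0 = l ∧ 1 = m then 1 else 0)
      + (if 0 = k ∧ 3 = l ∧ 0 = m then 1 else 0) = 0) :
    evalJet (affineJetOver p b c) (jetD U k l m (kpVariation V)) +
      r * evalJet (affineJetOver p b c) (jetD U 4 1 0 (kpVariation V)) = 0 := by
  have h := fiberD_kpVariation_eq_zero hV (affineJetOver p b c)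
    (Pi.single ![k, l, m] 1 + r • Pi.single ![4, 1, 0] 1) ?_ fun t => ?_
  · rw [fiberD_add_smul, map_add, map_smul] at h
    exact h
  · have h1 : (0 : Fin 3 → ℕ) ≠ ![k, l, m] := by
      rw [show (0 : Fin 3 → ℕ) = ![0, 0, 0] by decide, Ne, vec_eq_iff]
      omega
    simp [Pi.single_eq_of_ne h1]
  · have hc : ∀ k' l' m' : ℕ, 0 < k' + l' + m' → ((affineJetOver p b c).1 + t •
        ((0, Pi.single ![k, l, m] 1 + r • Pi.single ![4, 1, 0] 1) : Jet)).2 ![k', l', m'] =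
        (if k' = 0 ∧ l' = 1 ∧ m' = 0 then c else if k' = 1 ∧ l' = 0 ∧ m' = 0 then b else 0) +
        t * ((if k' = k ∧ l' = l ∧ m' = m then 1 else 0) +
          r * (if k' = 4 ∧ l' = 1 ∧ m' = 0 then 1 else 0)) := by
      intro k' l' m' hpos
      rw [← evalJet_affine_jw p b c k' l' m' hpos, evalJet_apply, jetCoord_apply]
      simp only [Prod.snd_add, Prod.smul_snd, Pi.add_apply, Pi.smul_apply, smul_eq_mul,
        Pi.single_apply, vec_eq_iff]
    simp only [higherKP, hc, Nat.reduceAdd, Nat.reduceLT]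
    -- A direction of order at least three leaves w_x, w_y, w_xx and w_xy unchanged, and the last
    -- two are zero. So Δ on the line is t times the left-hand side of `hr`.
    have e2 : ¬ (2 = k ∧ 0 = l ∧ 0 = m) := by omega
    have e3 : ¬ (1 = k ∧ 1 = l ∧ 0 = m) := by omega
    have e4 : ¬ (1 = k ∧ 0 = l ∧ 0 = m) := by omega
    have e5 : ¬ (0 = k ∧ 1 = l ∧ 0 = m) := by omega
    simp only [e2, e3, e4, e5, if_false]
    norm_num
    split_ifs at hr ⊢ <;> linear_combination t * hr

/-- The free first derivative b of the test jet acts as an indeterminate; values b = 0 and b = 1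
separate the coefficients. -/
theorem SmoothMap.eq_zero_of_affine {f g : SmoothMap U ℝ}
    (h : ∀ p : U, ∀ b : ℝ, f.1 p + g.1 p * b = 0) : f = 0 ∧ g = 0 := by
  have hf : ∀ p : U, f.1 p = 0 := fun p => by simpa using h p 0
  refine ⟨SmoothMap.ext_on fun p hp => hf ⟨p, hp⟩, SmoothMap.ext_on fun p hp => ?_⟩
  have h1 := h ⟨p, hp⟩ 1
  rw [hf, zero_add, mul_one] at h1
  exact h1

theorem jetD_zero_charAlg (V : VF U) : jetD U 0 0 0 (charAlg V) = pull (pd 3 (V.comp 3))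
    - pull (pd 3 (V.comp 0)) * jw U 1 0 0 - pull (pd 3 (V.comp 1)) * jw U 0 1 0
    - pull (pd 3 (V.comp 2)) * jw U 0 0 1 := by
  simp [charAlg, jetD_jw, jetD_zero_pull, mul_comm]

/-- The part of the determining equations that comes from the jet coordinates of order five. -/
theorem IsLiePointSymmetry.horizontal_components {V : VF U}
    (hV : IsLiePointSymmetry higherKP V) :
    (pd 1 (V.comp 0) = 0 ∧ pd 3 (V.comp 0) = 0) ∧ (pd 0 (V.comp 1) = 0 ∧ pd 3 (V.comp 1) = 0) ∧
      (pd 0 (V.comp 2) = 0 ∧ pd 3 (V.comp 2) = 0) ∧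
      (pd 1 (V.comp 2) = 0 ∧ pd 3 (V.comp 2) = 0) := by
  -- None of w_xxxxx, w_xxxyy, w_xxxyz, w_xxxxz occurs in Δ, so no correction is needed (r = 0). The
  -- coefficients are multiples of D_y ξ, D_x η, D_x τ and D_y τ.
  refine ⟨SmoothMap.eq_zero_of_affine fun p c => by
      have h := jetD_kpVariation_eq_zero p 0 c hV 5 0 0 0 (by norm_num) (by norm_num)
      simp [jetD_five_zero_zero_kpVariation, totalD_one_pull, evalJet_affine_pull,
        evalJet_affine_jw] at h
      linear_combination -h,
    SmoothMap.eq_zero_of_affine fun p b => by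
      have h := jetD_kpVariation_eq_zero p b 0 hV 3 2 0 0 (by norm_num) (by norm_num)
      simp [jetD_three_two_zero_kpVariation, totalD_zero_pull, evalJet_affine_pull,
        evalJet_affine_jw] at h
      exact h,
    SmoothMap.eq_zero_of_affine fun p b => by
      have h := jetD_kpVariation_eq_zero p b 0 hV 3 1 1 0 (by norm_num) (by norm_num)
      simp [jetD_three_one_one_kpVariation, totalD_zero_pull, evalJet_affine_pull,
        evalJet_affine_jw] at h
      exact h,
    SmoothMap.eq_zero_of_affine fun p c => by
      have h := jetD_kpVariation_eq_zero p 0 c hV 4 0 1 0 (by norm_num) (by norm_num)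
      simp [jetD_four_zero_one_kpVariation, totalD_one_pull, evalJet_affine_pull,
        evalJet_affine_jw] at h
      linear_combination -h⟩

-- Once ξ, η, τ are independent of w, the coefficients of order four and three simplify enough to be
-- read one by one; each result removes terms from the next coefficient.
set_option maxHeartbeats 1000000 in
theorem DeterminingEquations.of_isLiePointSymmetry {V : VF U}
    (hV : IsLiePointSymmetry higherKP V) : DeterminingEquations V := by
  obtain ⟨⟨xi_y, xi_w⟩, ⟨eta_x, eta_w⟩, ⟨tau_x, tau_w⟩, tau_y, -⟩ := hV.horizontal_components
  have N : jetD U 0 0 0 (charAlg V) = pull (pd 3 (V.comp 3)) := by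
    simp [jetD_zero_charAlg, xi_w, eta_w, tau_w]
  have ξx : totalD U 0 (pull (V.comp 0)) = pull (pd 0 (V.comp 0)) := by
    simp [totalD_zero_pull, xi_w]
  have ξy : totalD U 1 (pull (V.comp 0)) = 0 := by simp [totalD_one_pull, xi_y, xi_w]
  have ξz : totalD U 2 (pull (V.comp 0)) = pull (pd 2 (V.comp 0)) := by
    simp [totalD_two_pull, xi_w]
  have ηx : totalD U 0 (pull (V.comp 1)) = 0 := by simp [totalD_zero_pull, eta_x, eta_w]
  have ηy : totalD U 1 (pull (V.comp 1)) = pull (pd 1 (V.comp 1)) := by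
    simp [totalD_one_pull, eta_w]
  have ηxy : totalD U 0 (pull (pd 1 (V.comp 1))) = 0 := by
    rw [← ηy, totalD_comm, ηx, map_zero]
  have ηz : totalD U 2 (pull (V.comp 1)) = pull (pd 2 (V.comp 1)) := by
    simp [totalD_two_pull, eta_w]
  have τx : totalD U 0 (pull (V.comp 2)) = 0 := by simp [totalD_zero_pull, tau_x, tau_w]
  have τy : totalD U 1 (pull (V.comp 2)) = 0 := by simp [totalD_one_pull, tau_y, tau_w]
  have τz : totalD U 2 (pull (V.comp 2)) = pull (pd 2 (V.comp 2)) := by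
    simp [totalD_two_pull, tau_w]
  have ξxx : totalD U 0 (pull (pd 0 (V.comp 0))) = pull (pd 0 (pd 0 (V.comp 0))) := by
    simp [totalD_zero_pull, pd_comm 3 0, xi_w]
  -- From w_xxxx: D_y φ_w = φ_wy + c φ_ww vanishes for every c.
  have phi_wyw : pd 1 (pd 3 (V.comp 3)) = 0 ∧ pd 3 (pd 3 (V.comp 3)) = 0 :=
    SmoothMap.eq_zero_of_affine fun p c => by
      have h := jetD_kpVariation_eq_zero p 0 c hV 4 0 0 0 (by norm_num) (by norm_num)
      simp [jetD_four_zero_zero_kpVariation, N, ξy, totalD_one_pull, evalJet_affine_pull,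
        evalJet_affine_jw] at h
      exact h
  obtain ⟨phi_wy, phi_ww⟩ := phi_wyw
  have eta_y : pd 1 (V.comp 1) = (2 : ℝ) • pd 0 (V.comp 0) := by
    refine SmoothMap.ext_on fun p hp => ?_
    -- Both w_yyy and w_xxxxy have coefficient 1 in Δ, hence r = -1. Then φ_w cancels and 4 ξ_x - 2
    -- η_y = 0 remains.
    have h := jetD_kpVariation_eq_zero ⟨p, hp⟩ 0 0 hV 0 3 0 (-1) (by norm_num) (by norm_num)
    simp [jetD_zero_three_zero_kpVariation, jetD_four_one_zero_kpVariation, N, ξx, ηy,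
      evalJet_affine_pull] at h
    simp only [Submodule.coe_smul, Pi.smul_apply, smul_eq_mul]
    linear_combination -h / 2
  have xi_xx : pd 0 (pd 0 (V.comp 0)) = 0 := by
    have h : (2 : ℝ) • pd 0 (pd 0 (V.comp 0)) = 0 := by
      rw [← map_smul, ← eta_y, pd_comm, eta_x, map_zero]
    simpa using h
  have phi_wx : pd 0 (pd 3 (V.comp 3)) = 0 := by
    refine SmoothMap.ext_on fun p hp => ?_
    have h := jetD_kpVariation_eq_zero ⟨p, hp⟩ 0 0 hV 3 1 0 0 (by norm_num) (by norm_num)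
    simpa [jetD_three_one_zero_kpVariation, N, ξx, ξxx, xi_xx, ηy, ηxy, totalD_zero_pull,
      evalJet_affine_pull, phi_ww] using h
  have Nx : totalD U 0 (pull (pd 3 (V.comp 3))) = 0 := by
    simp [totalD_zero_pull, phi_wx, phi_ww]
  have Ny : totalD U 1 (pull (pd 3 (V.comp 3))) = 0 := by
    simp [totalD_one_pull, phi_wy, phi_ww]
  have tau_z : pd 2 (V.comp 2) = (4 : ℝ) • pd 0 (V.comp 0) := by
    refine SmoothMap.ext_on fun p hp => ?_
    -- Here r = 2 offsets the term -2 w_xxz; again φ_w cancels and 2 τ_z - 4 ξ_x - 2 η_y = 0.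
    have h := jetD_kpVariation_eq_zero ⟨p, hp⟩ 0 0 hV 2 0 1 2 (by norm_num) (by norm_num)
    simp [jetD_two_zero_one_kpVariation, jetD_four_one_zero_kpVariation, N, ξx, ηy, τx, τy, τz,
      evalJet_affine_pull, eta_y] at h
    simp only [Submodule.coe_smul, Pi.smul_apply, smul_eq_mul]
    linear_combination h / 2
  have Qx : totalD U 0 (charAlg V) = pull (pd 0 (V.comp 3)) + pull (pd 3 (V.comp 3)) * jw U 1 0 0
      - pull (pd 0 (V.comp 0)) * jw U 1 0 0 - pull (V.comp 0) * jw U 2 0 0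
      - pull (V.comp 1) * jw U 1 1 0 - pull (V.comp 2) * jw U 1 0 1 := by
    simp only [charAlg, map_sub, Derivation.leibniz, ξx, ηx, τx, totalD_zero_pull (V.comp 3),
      totalD_zero_jw, smul_eq_mul]
    ring
  have Qy : totalD U 1 (charAlg V) = pull (pd 1 (V.comp 3)) + pull (pd 3 (V.comp 3)) * jw U 0 1 0
      - pull (pd 1 (V.comp 1)) * jw U 0 1 0 - pull (V.comp 0) * jw U 1 1 0
      - pull (V.comp 1) * jw U 0 2 0 - pull (V.comp 2) * jw U 0 1 1 := by
    simp only [charAlg, map_sub, Derivation.leibniz, ξy, ηy, τy, totalD_one_pull (V.comp 3),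
      totalD_one_jw, smul_eq_mul]
    ring
  -- From w_xxy, whose coefficient in Δ is 4 w_x = 4b, hence r = -4b. The part constant in b gives
  -- φ_x, the linear part gives φ_w.
  have h_x : ∀ p : U, ∀ b : ℝ, (2 * (pd 0 (V.comp 3)).1 p + (pd 2 (V.comp 1)).1 p)
      + 2 * ((pd 3 (V.comp 3)).1 p + (pd 0 (V.comp 0)).1 p) * b = 0 := fun p b => by
    have h := jetD_kpVariation_eq_zero p b 0 hV 2 1 0 (-4 * b) (by norm_num) (by norm_num)
    simp [jetD_two_one_zero_kpVariation, jetD_four_one_zero_kpVariation, N, ξx, ξxx, xi_xx, ηx,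
      ηy, ηz, Nx, Qx, evalJet_affine_pull, evalJet_affine_jw, eta_y] at h
    linear_combination h / 2
  -- From w_xxx, whose coefficient in Δ is 2 w_y = 2c, hence r = -2c.
  have h_y : ∀ p : U, ∀ c : ℝ, (2 * (pd 1 (V.comp 3)).1 p + 2 * (pd 2 (V.comp 0)).1 p)
      + 2 * ((pd 3 (V.comp 3)).1 p + (pd 0 (V.comp 0)).1 p) * c = 0 := fun p c => by
    have h := jetD_kpVariation_eq_zero p 0 c hV 3 0 0 (-2 * c) (by norm_num) (by norm_num)
    simp [jetD_three_zero_zero_kpVariation, jetD_four_one_zero_kpVariation, N, ξx, ξy, ξz,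
      ηy, Ny, Qy, evalJet_affine_pull, evalJet_affine_jw, eta_y] at h
    linear_combination h
  refine ⟨xi_y, xi_w, eta_x, eta_w, tau_x, tau_y, tau_w, eta_y, tau_z, ?_, ?_, ?_⟩
  · refine SmoothMap.ext_on fun p hp => ?_
    simp only [Submodule.coe_neg, Pi.neg_apply]
    linear_combination h_x ⟨p, hp⟩ 1 / 2 - h_x ⟨p, hp⟩ 0 / 2
  · refine SmoothMap.ext_on fun p hp => ?_
    simp only [Submodule.coe_neg, Pi.neg_apply, Submodule.coe_smul, Pi.smul_apply, smul_eq_mul]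
    linear_combination h_x ⟨p, hp⟩ 0 / 2
  · refine SmoothMap.ext_on fun p hp => ?_
    simp only [Submodule.coe_neg, Pi.neg_apply]
    linear_combination h_y ⟨p, hp⟩ 0 / 2

end

section

/-! ### Calculus of functions of the time variable -/

namespace CInf

variable {J : Opens ℝ}

theorem D_apply (f : CInf J) {z : ℝ} (hz : z ∈ J) : f.D.1 z = deriv f.1 z :=
  ofSmoothOn_apply _ hz

theorem hasDerivAt (f : CInf J) {z : ℝ} (hz : z ∈ J) : HasDerivAt f.1 (f.D.1 z) z := by
  rw [D_apply f hz]
  exact (SmoothMap.differentiableAt f hz).hasDerivAt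

theorem deriv_deriv (f : CInf J) {z : ℝ} (hz : z ∈ J) : deriv (deriv f.1) z = f.D.D.1 z := by
  rw [D_apply f.D hz]
  refine Filter.EventuallyEq.deriv_eq ?_
  filter_upwards [J.isOpen.mem_nhds hz] with y hy
  exact (D_apply f hy).symm

theorem mul_apply (f g : CInf J) (z : ℝ) : (f * g).1 z = f.1 z * g.1 z := rfl
theorem add_apply (f g : CInf J) (z : ℝ) : (f + g).1 z = f.1 z + g.1 z := rfl
theorem sub_apply (f g : CInf J) (z : ℝ) : (f - g).1 z = f.1 z - g.1 z := rfl
theorem smul_apply (c : ℝ) (f : CInf J) (z : ℝ) : (c • f).1 z = c * f.1 z := rfl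

theorem D_eq_of_hasDerivAt {f g : CInf J} (h : ∀ z ∈ J, HasDerivAt f.1 (g.1 z) z) : f.D = g :=
  SmoothMap.ext_on fun z hz => by rw [D_apply f hz, (h z hz).deriv]

theorem D_mul (f g : CInf J) : (f * g).D = f.D * g + f * g.D :=
  D_eq_of_hasDerivAt fun _ hz => (f.hasDerivAt hz).mul (g.hasDerivAt hz)

theorem D_add (f g : CInf J) : (f + g).D = f.D + g.D :=
  D_eq_of_hasDerivAt fun _ hz => (f.hasDerivAt hz).add (g.hasDerivAt hz)

theorem D_sub (f g : CInf J) : (f - g).D = f.D - g.D :=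
  D_eq_of_hasDerivAt fun _ hz => (f.hasDerivAt hz).sub (g.hasDerivAt hz)

theorem D_smul (c : ℝ) (f : CInf J) : (c • f).D = c • f.D :=
  D_eq_of_hasDerivAt fun _ hz => (f.hasDerivAt hz).const_mul c

theorem D_zero : (0 : CInf J).D = 0 :=
  D_eq_of_hasDerivAt fun z _ => hasDerivAt_const z 0

end CInf

variable {U : Opens (Fin 4 → ℝ)}

/-! ### Components of vector fields -/

theorem VF.comp_sub (V W : VF U) (i : Fin 4) : (V - W).comp i = V.comp i - W.comp i := rfl

theorem VF.fderiv_apply (V : VF U) {p : Fin 4 → ℝ} (hp : p ∈ U) (v : Fin 4 → ℝ) (i : Fin 4) :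
    fderiv ℝ V.1 p v i = fderiv ℝ (V.comp i).1 p v := by
  have h := (hasFDerivAt_pi'.1 (V.diff hp).hasFDerivAt i).fderiv
  have h2 : fderiv ℝ (V.comp i).1 p = fderiv ℝ (fun q => V.1 q i) p := rfl
  rw [h2, h]
  rfl

theorem VF.lie_comp (V W : VF U) {p : Fin 4 → ℝ} (hp : p ∈ U) (i : Fin 4) :
    (⁅V, W⁆ : VF U).1 p i =
      fderiv ℝ (W.comp i).1 p (V.1 p) - fderiv ℝ (V.comp i).1 p (W.1 p) := by
  rw [VF.lie_apply V W hp, lieBracket_eq, ← VF.fderiv_apply W hp, ← VF.fderiv_apply V hp]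
  rfl

theorem mem_zRange {p : Fin 4 → ℝ} (hp : p ∈ U) : p 2 ∈ zRange U := ⟨p, hp, rfl⟩

theorem zRange_ext {f g : CInf (zRange U)} (h : ∀ p ∈ U, f.1 (p 2) = g.1 (p 2)) : f = g :=
  SmoothMap.ext_on fun _ ⟨p, hp, hz⟩ => hz ▸ h p hp

variable (U) in
/-- The field `Z(f) + Y(g) + X(h) + W(k)`. -/
def genField (f g h k : CInf (zRange U)) : VF U := Z U f + Y U g + X U h + W U k

section Components

variable (f g h k : CInf (zRange U)) {p : Fin 4 → ℝ}

theorem genField_apply (hp : p ∈ U) : (genField U f g h k).1 p =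
    ![1 / 4 * f.D.1 (p 2) * p 0 + h.1 (p 2), 1 / 2 * f.D.1 (p 2) * p 1 + g.1 (p 2), f.1 (p 2),
      -(1 / 4) * (p 3 * f.D.1 (p 2) + p 0 * p 1 * f.D.D.1 (p 2)) - 1 / 2 * p 0 * g.D.1 (p 2)
        - p 1 * h.D.1 (p 2) + k.1 (p 2)] := by
  have hz : (Z U f).1 p = _ := ofSmoothOn_apply _ hp
  have hy : (Y U g).1 p = _ := ofSmoothOn_apply _ hp
  have hx : (X U h).1 p = _ := ofSmoothOn_apply _ hp
  have hw : (W U k).1 p = _ := ofSmoothOn_apply _ hp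
  have hs : (genField U f g h k).1 p =
    (Z U f).1 p + (Y U g).1 p + (X U h).1 p + (W U k).1 p := rfl
  rw [hs, hz, hy, hx, hw, CInf.deriv_deriv f (mem_zRange hp), ← CInf.D_apply f (mem_zRange hp),
    ← CInf.D_apply g (mem_zRange hp), ← CInf.D_apply h (mem_zRange hp)]
  funext i
  fin_cases i <;> simp <;> ring

theorem hasFDerivAt_coord (i : Fin 4) (p : Fin 4 → ℝ) : HasFDerivAt (fun q : Fin 4 → ℝ => q i)
    (ContinuousLinearMap.proj (R := ℝ) (φ := fun _ : Fin 4 => ℝ) i) p :=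
  hasFDerivAt_apply i p

theorem CInf.hasFDerivAt_comp_z (hp : p ∈ U) : HasFDerivAt (fun q : Fin 4 → ℝ => f.1 (q 2))
    (f.D.1 (p 2) • ContinuousLinearMap.proj (R := ℝ) (φ := fun _ : Fin 4 => ℝ) 2) p :=
  HasDerivAt.comp_hasFDerivAt p (f.hasDerivAt (mem_zRange hp)) (hasFDerivAt_coord 2 p)

/-- Fields are extended by zero outside U, so explicit formulas hold only on U; openness of U makes
this enough for derivatives. -/
theorem fderiv_comp_eq {V : VF U} {i : Fin 4} {F : (Fin 4 → ℝ) → ℝ} {F' : (Fin 4 → ℝ) →L[ℝ] ℝ}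
    (hp : p ∈ U) (hV : ∀ q ∈ U, V.1 q i = F q) (hF : HasFDerivAt F F' p) :
    fderiv ℝ (V.comp i).1 p = F' := by
  refine (Filter.EventuallyEq.fderiv_eq ?_).trans hF.fderiv
  filter_upwards [U.isOpen.mem_nhds hp] with q hq
  exact hV q hq

variable (v : Fin 4 → ℝ)

theorem fderiv_genField_zero (hp : p ∈ U) : fderiv ℝ ((genField U f g h k).comp 0).1 p v =
    1 / 4 * f.D.1 (p 2) * v 0 + (1 / 4 * f.D.D.1 (p 2) * p 0 + h.D.1 (p 2)) * v 2 := by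
  rw [fderiv_comp_eq hp (fun q hq => by rw [genField_apply f g h k hq]; rfl)
    ((((f.D.hasFDerivAt_comp_z hp).const_mul (1 / 4)).mul (hasFDerivAt_coord 0 p)).add
      (h.hasFDerivAt_comp_z hp))]
  simp
  ring

theorem fderiv_genField_one (hp : p ∈ U) : fderiv ℝ ((genField U f g h k).comp 1).1 p v =
    1 / 2 * f.D.1 (p 2) * v 1 + (1 / 2 * f.D.D.1 (p 2) * p 1 + g.D.1 (p 2)) * v 2 := by
  rw [fderiv_comp_eq hp (fun q hq => by rw [genField_apply f g h k hq]; rfl)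
    ((((f.D.hasFDerivAt_comp_z hp).const_mul (1 / 2)).mul (hasFDerivAt_coord 1 p)).add
      (g.hasFDerivAt_comp_z hp))]
  simp
  ring

theorem fderiv_genField_two (hp : p ∈ U) :
    fderiv ℝ ((genField U f g h k).comp 2).1 p v = f.D.1 (p 2) * v 2 := by
  rw [fderiv_comp_eq hp (fun q hq => by rw [genField_apply f g h k hq]; rfl)
    (f.hasFDerivAt_comp_z hp)]
  simp

theorem fderiv_genField_three (hp : p ∈ U) : fderiv ℝ ((genField U f g h k).comp 3).1 p v =
    (-(1 / 4) * p 1 * f.D.D.1 (p 2) - 1 / 2 * g.D.1 (p 2)) * v 0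
      + (-(1 / 4) * p 0 * f.D.D.1 (p 2) - h.D.1 (p 2)) * v 1
      + (-(1 / 4) * (p 3 * f.D.D.1 (p 2) + p 0 * p 1 * f.D.D.D.1 (p 2))
        - 1 / 2 * p 0 * g.D.D.1 (p 2) - p 1 * h.D.D.1 (p 2) + k.D.1 (p 2)) * v 2
      - 1 / 4 * f.D.1 (p 2) * v 3 := by
  have c := fun i => hasFDerivAt_coord i p
  rw [fderiv_comp_eq hp (fun q hq => by rw [genField_apply f g h k hq]; rfl)
    ((((((c 3).mul (f.D.hasFDerivAt_comp_z hp)).add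
      (((c 0).mul (c 1)).mul (f.D.D.hasFDerivAt_comp_z hp))).const_mul (-(1 / 4))).sub
      (((c 0).const_mul (1 / 2)).mul (g.D.hasFDerivAt_comp_z hp))).sub
      ((c 1).mul (h.D.hasFDerivAt_comp_z hp)) |>.add (k.hasFDerivAt_comp_z hp))]
  simp
  ring

end Components

/-- The components τ, η, ξ, φ determine f, g, h, k in this order, each after the contributions of
the earlier ones are identified. -/
theorem genField_injective {f g h k f' g' h' k' : CInf (zRange U)}
    (heq : genField U f g h k = genField U f' g' h' k') :
    f = f' ∧ g = g' ∧ h = h' ∧ k = k' := by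
  have key : ∀ p ∈ U, ∀ i, (genField U f g h k).1 p i = (genField U f' g' h' k').1 p i :=
    fun p _ i => by rw [heq]
  have hf : f = f' := zRange_ext fun p hp => by
    simpa [genField_apply _ _ _ _ hp] using key p hp 2
  subst hf
  have hg : g = g' := zRange_ext fun p hp => by
    simpa [genField_apply _ _ _ _ hp] using key p hp 1
  have hh : h = h' := zRange_ext fun p hp => by
    simpa [genField_apply _ _ _ _ hp] using key p hp 0
  subst hg hh
  exact ⟨rfl, rfl, rfl, zRange_ext fun p hp => by
    simpa [genField_apply _ _ _ _ hp] using key p hp 3⟩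

/-- The commutator of two fields of the form `Z(f) + Y(g) + X(h) + W(k)`. -/
theorem lie_genField (f₁ g₁ h₁ k₁ f₂ g₂ h₂ k₂ : CInf (zRange U)) :
    ⁅genField U f₁ g₁ h₁ k₁, genField U f₂ g₂ h₂ k₂⁆ =
      genField U (f₁ * f₂.D - f₁.D * f₂)
        (f₁ * g₂.D - (1 / 2 : ℝ) • (f₁.D * g₂) - (f₂ * g₁.D - (1 / 2 : ℝ) • (f₂.D * g₁)))
        (f₁ * h₂.D - (1 / 4 : ℝ) • (f₁.D * h₂) - (f₂ * h₁.D - (1 / 4 : ℝ) • (f₂.D * h₁)))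
        (f₁ * k₂.D + (1 / 4 : ℝ) • (f₁.D * k₂) - (f₂ * k₁.D + (1 / 4 : ℝ) • (f₂.D * k₁))
          + (g₂ * h₁.D - (1 / 2 : ℝ) • (g₂.D * h₁))
          - (g₁ * h₂.D - (1 / 2 : ℝ) • (g₁.D * h₂))) := by
  refine VF.ext_on fun p hp => ?_
  rw [genField_apply _ _ _ _ hp]
  funext i
  rw [VF.lie_comp _ _ hp i]
  have s0 : ∀ a b c d : ℝ, ![a, b, c, d] 0 = a := fun _ _ _ _ => rfl
  have s1 : ∀ a b c d : ℝ, ![a, b, c, d] 1 = b := fun _ _ _ _ => rfl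
  have s2 : ∀ a b c d : ℝ, ![a, b, c, d] 2 = c := fun _ _ _ _ => rfl
  have s3 : ∀ a b c d : ℝ, ![a, b, c, d] 3 = d := fun _ _ _ _ => rfl
  match i with
  | 0 =>
    simp only [fderiv_genField_zero _ _ _ _ _ hp, genField_apply _ _ _ _ hp, s0, s2,
      CInf.D_sub, CInf.D_mul, CInf.mul_apply, CInf.add_apply, CInf.sub_apply, CInf.smul_apply]
    ring
  | 1 =>
    simp only [fderiv_genField_one _ _ _ _ _ hp, genField_apply _ _ _ _ hp, s1, s2,
      CInf.D_sub, CInf.D_mul, CInf.mul_apply, CInf.add_apply, CInf.sub_apply, CInf.smul_apply]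
    ring
  | 2 =>
    simp only [fderiv_genField_two _ _ _ _ _ hp, genField_apply _ _ _ _ hp, s2,
      CInf.mul_apply, CInf.sub_apply]
    ring
  | 3 =>
    simp only [fderiv_genField_three _ _ _ _ _ hp, genField_apply _ _ _ _ hp, s0, s1, s2, s3,
      CInf.D_sub, CInf.D_add, CInf.D_mul, CInf.D_smul, CInf.mul_apply, CInf.add_apply,
      CInf.sub_apply, CInf.smul_apply]
    ring

/-! ### Integration of the determining equations -/

theorem genField_determiningEquations (f g h k : CInf (zRange U)) :
    DeterminingEquations (genField U f g h k) := by
  constructor <;> refine SmoothMap.ext_on fun p hp => ?_ <;>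
    simp [pd_apply _ _ hp, fderiv_genField_zero _ _ _ _ _ hp, fderiv_genField_one _ _ _ _ _ hp,
      fderiv_genField_two _ _ _ _ _ hp, fderiv_genField_three _ _ _ _ _ hp] <;> ring

/-- Linearity lets the known solutions be subtracted one after another. -/
theorem DeterminingEquations.sub {V W : VF U} (hV : DeterminingEquations V)
    (hW : DeterminingEquations W) : DeterminingEquations (V - W) := by
  constructor <;> simp only [VF.comp_sub, map_sub, smul_sub, hV.xi_y, hW.xi_y, hV.xi_w, hW.xi_w,
    hV.eta_x, hW.eta_x, hV.eta_w, hW.eta_w, hV.tau_x, hW.tau_x, hV.tau_y, hW.tau_y, hV.tau_w,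
    hW.tau_w, hV.eta_y, hW.eta_y, hV.tau_z, hW.tau_z, hV.phi_w, hW.phi_w, hV.phi_x, hW.phi_x,
    hV.phi_y, hW.phi_y, sub_self] <;> abel

/-- On a convex set, a function whose partial derivatives along `x`, `y`, `w` vanish is a smooth
function of `z`. -/
theorem exists_eq_comp_z (hU : Convex ℝ (U : Set (Fin 4 → ℝ))) {a : SmoothMap U ℝ}
    (h0 : pd 0 a = 0) (h1 : pd 1 a = 0) (h3 : pd 3 a = 0) :
    ∃ f : CInf (zRange U), ∀ p ∈ U, a.1 p = f.1 (p 2) := by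
  classical
  -- The segment between two points of a slice stays in U by convexity, and its direction has no
  -- z-component, so only vanishing partial derivatives enter.
  have hconst : ∀ p ∈ U, ∀ q ∈ U, p 2 = q 2 → a.1 p = a.1 q := by
    intro p hp q hq hpq
    have hmem : ∀ t ∈ Set.Icc (0 : ℝ) 1, p + t • (q - p) ∈ U := fun t ht =>
      hU.add_smul_sub_mem hp hq ht
    have hd : ∀ t ∈ Set.Icc (0 : ℝ) 1,
        HasDerivAt (fun t : ℝ => a.1 (p + t • (q - p))) 0 t := by
      intro t ht
      have hl : HasDerivAt (fun t : ℝ => p + t • (q - p)) (q - p) t := by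
        simpa using ((hasDerivAt_id t).smul_const (q - p)).const_add p
      have hc := (SmoothMap.differentiableAt a (hmem t ht)).hasFDerivAt.comp_hasDerivAt t hl
      have hz : fderiv ℝ a.1 (p + t • (q - p)) (q - p) = 0 := by
        rw [fderiv_eq_sum_pd a (hmem t ht), Fin.sum_univ_four, h0, h1, h3]
        simp [hpq]
      rw [hz] at hc
      exact hc
    have h := constant_of_derivWithin_zero
      (fun t ht => (hd t ht).differentiableAt.differentiableWithinAt)
      (fun t ht => (hd t ⟨ht.1, ht.2.le⟩).hasDerivWithinAt.derivWithin
        (uniqueDiffOn_Icc one_pos t ⟨ht.1, ht.2.le⟩)) 1 ⟨zero_le_one, le_rfl⟩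
    simpa using h.symm
  have hex : ∀ z ∈ zRange U, ∃ p ∈ U, p 2 = z := fun z hz => hz
  -- The section s is arbitrary and need not be continuous.
  choose! s hsU hs using hex
  have hsmooth : ContDiffOn ℝ ∞ (fun z => a.1 (s z)) (zRange U) := by
    intro z hz
    -- Near z the arbitrary section is replaced by the line through s(z) parallel to the z-axis; the
    -- value of a depends only on z, so smoothness along that line suffices.
    have hup : ContDiff ℝ ∞ fun y : ℝ => s z + (y - z) • (Pi.single 2 1 : Fin 4 → ℝ) := by
      fun_prop
    have hz0 : s z + (z - z) • (Pi.single 2 1 : Fin 4 → ℝ) = s z := by simp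
    have hnear : ∀ᶠ y in nhds z, s z + (y - z) • (Pi.single 2 1 : Fin 4 → ℝ) ∈ U :=
      hup.continuous.continuousAt.eventually (U.isOpen.mem_nhds
        (show s z + (z - z) • (Pi.single 2 1 : Fin 4 → ℝ) ∈ U by rw [hz0]; exact hsU z hz))
    have hsm : ContDiffAt ℝ ∞
        (fun y => a.1 (s z + (y - z) • (Pi.single 2 1 : Fin 4 → ℝ))) z := by
      refine ContDiffAt.comp z ?_ hup.contDiffAt
      rw [hz0]
      exact SmoothMap.contDiffAt a (hsU z hz)
    refine (hsm.congr_of_eventuallyEq ?_).contDiffWithinAt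
    filter_upwards [hnear, (zRange U).isOpen.mem_nhds hz] with y hy hyJ
    refine hconst _ (hsU y hyJ) _ hy ?_
    simp [hs y hyJ, hs z hz]
  refine ⟨ofSmoothOn _ _ hsmooth, fun p hp => ?_⟩
  refine Eq.trans ?_ (ofSmoothOn_apply hsmooth (mem_zRange hp)).symm
  exact hconst _ hp _ (hsU _ (mem_zRange hp)) (hs _ (mem_zRange hp)).symm

theorem VF.comp_apply (V : VF U) (i : Fin 4) (p : Fin 4 → ℝ) : (V.comp i).1 p = V.1 p i := rfl

theorem DeterminingEquations.exists_genField (hU : Convex ℝ (U : Set (Fin 4 → ℝ))) {V : VF U}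
    (hV : DeterminingEquations V) :
    ∃ f g h k : CInf (zRange U), V = genField U f g h k := by
  obtain ⟨f, hf⟩ := exists_eq_comp_z hU hV.tau_x hV.tau_y hV.tau_w
  have hV1 := hV.sub (genField_determiningEquations f 0 0 0)
  set V1 := V - genField U f 0 0 0 with hV1_def
  have hτ : V1.comp 2 = 0 := SmoothMap.ext_on fun p hp => by
    have h : (V1.comp 2).1 p = (V.comp 2).1 p - (genField U f 0 0 0).1 p 2 := rfl
    rw [h, hf p hp, genField_apply _ _ _ _ hp]
    simp
  -- With τ removed, τ_z = 4 ξ_x forces ξ_x = 0, and then η_y = 2 ξ_x = 0, so ξ and η depend on z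
  -- only.
  have hξx : pd 0 (V1.comp 0) = 0 := by
    have h4 := hV1.tau_z
    rw [hτ, map_zero] at h4
    simpa using h4.symm
  have hηy : pd 1 (V1.comp 1) = 0 := by rw [hV1.eta_y, hξx, smul_zero]
  obtain ⟨h, hh⟩ := exists_eq_comp_z hU hξx hV1.xi_y hV1.xi_w
  obtain ⟨g, hg⟩ := exists_eq_comp_z hU hV1.eta_x hηy hV1.eta_w
  have hV2 := hV1.sub (genField_determiningEquations 0 g h 0)
  set V2 := V1 - genField U 0 g h 0 with hV2_def
  have hξ : V2.comp 0 = 0 := SmoothMap.ext_on fun p hp => by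
    have h' : (V2.comp 0).1 p = (V1.comp 0).1 p - (genField U 0 g h 0).1 p 0 := rfl
    rw [h', hh p hp, genField_apply _ _ _ _ hp]
    simp [CInf.D_zero]
  have hη : V2.comp 1 = 0 := SmoothMap.ext_on fun p hp => by
    have h' : (V2.comp 1).1 p = (V1.comp 1).1 p - (genField U 0 g h 0).1 p 1 := rfl
    rw [h', hg p hp, genField_apply _ _ _ _ hp]
    simp [CInf.D_zero]
  -- With ξ = η = 0 the equations for φ say that φ_x, φ_y and φ_w all vanish.
  obtain ⟨k, hk⟩ := exists_eq_comp_z hU (a := V2.comp 3)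
    (by rw [hV2.phi_x, hη, map_zero, smul_zero, neg_zero])
    (by rw [hV2.phi_y, hξ, map_zero, neg_zero])
    (by rw [hV2.phi_w, hξ, map_zero, neg_zero])
  refine ⟨f, g, h, k, VF.ext_on fun p hp => funext fun i => ?_⟩
  have e0 : V1.1 p = V.1 p - (genField U f 0 0 0).1 p := rfl
  have hf := hf p hp
  have hh := hh p hp
  have hg := hg p hp
  have hk := hk p hp
  have e3 : (V2.comp 3).1 p = (V1.1 p - (genField U 0 g h 0).1 p) 3 := rfl
  rw [e3] at hk
  simp only [VF.comp_apply, e0, Pi.sub_apply] at hf hh hg hk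
  rw [genField_apply _ _ _ _ hp] at hh hg hk ⊢
  rw [genField_apply _ _ _ _ hp] at hk
  fin_cases i <;> simp [CInf.D_zero] at hf hh hg hk ⊢ <;> linarith

end

section

variable {U : Opens (Fin 4 → ℝ)}

/-! ### The four families inside the symmetry algebra -/

theorem VF.zero_apply (p : Fin 4 → ℝ) (i : Fin 4) : (0 : VF U).1 p i = 0 := rfl

theorem Z_zero : Z U 0 = 0 := VF.ext_on fun p hp => by
  refine (ofSmoothOn_apply _ hp).trans ?_
  funext i
  fin_cases i <;> simp [VF.zero_apply]

theorem Y_zero : Y U 0 = 0 := VF.ext_on fun p hp => by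
  refine (ofSmoothOn_apply _ hp).trans ?_
  funext i
  fin_cases i <;> simp [VF.zero_apply]

theorem X_zero : X U 0 = 0 := VF.ext_on fun p hp => by
  refine (ofSmoothOn_apply _ hp).trans ?_
  funext i
  fin_cases i <;> simp [VF.zero_apply]

theorem W_zero : W U 0 = 0 := VF.ext_on fun p hp => by
  refine (ofSmoothOn_apply _ hp).trans ?_
  funext i
  fin_cases i <;> simp [VF.zero_apply]

theorem genField_Z (f : CInf (zRange U)) : genField U f 0 0 0 = Z U f := by
  simp [genField, Y_zero, X_zero, W_zero]

theorem genField_Y (g : CInf (zRange U)) : genField U 0 g 0 0 = Y U g := by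
  simp [genField, Z_zero, X_zero, W_zero]

theorem genField_X (h : CInf (zRange U)) : genField U 0 0 h 0 = X U h := by
  simp [genField, Z_zero, Y_zero, W_zero]

theorem genField_W (k : CInf (zRange U)) : genField U 0 0 0 k = W U k := by
  simp [genField, Z_zero, Y_zero, X_zero]

theorem genField_YXW (g h k : CInf (zRange U)) : genField U 0 g h k = Y U g + X U h + W U k := by
  simp [genField, Z_zero]

theorem genField_zero : genField U 0 0 0 0 = 0 := by
  simp [genField, Z_zero, Y_zero, X_zero, W_zero]

theorem genField_add (f g h k f' g' h' k' : CInf (zRange U)) :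
    genField U f g h k + genField U f' g' h' k' =
      genField U (f + f') (g + g') (h + h') (k + k') := by
  refine VF.ext_on fun p hp => ?_
  rw [VF.add_coe, Pi.add_apply, genField_apply _ _ _ _ hp, genField_apply _ _ _ _ hp,
    genField_apply _ _ _ _ hp]
  funext i
  fin_cases i <;> simp [CInf.D_add, CInf.add_apply] <;> ring

theorem genField_smul (c : ℝ) (f g h k : CInf (zRange U)) :
    c • genField U f g h k = genField U (c • f) (c • g) (c • h) (c • k) := by
  refine VF.ext_on fun p hp => ?_
  rw [VF.smul_coe, Pi.smul_apply, genField_apply _ _ _ _ hp, genField_apply _ _ _ _ hp]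
  funext i
  fin_cases i <;> simp [CInf.D_smul, CInf.smul_apply] <;> ring

variable (U) in
/-- The Lie algebra of all fields `Z(f) + Y(g) + X(h) + W(k)`. -/
def symmetryAlgebra : LieSubalgebra ℝ (VF U) where
  carrier := {V | ∃ f g h k, V = genField U f g h k}
  add_mem' := by
    rintro _ _ ⟨f, g, h, k, rfl⟩ ⟨f', g', h', k', rfl⟩
    exact ⟨_, _, _, _, genField_add _ _ _ _ _ _ _ _⟩
  zero_mem' := ⟨0, 0, 0, 0, genField_zero.symm⟩
  smul_mem' := by
    rintro c _ ⟨f, g, h, k, rfl⟩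
    exact ⟨_, _, _, _, genField_smul _ _ _ _ _⟩
  lie_mem' := by
    rintro _ _ ⟨f, g, h, k, rfl⟩ ⟨f', g', h', k', rfl⟩
    exact ⟨_, _, _, _, lie_genField _ _ _ _ _ _ _ _⟩

theorem lie_genField_YXW (g₁ h₁ k₁ g₂ h₂ k₂ : CInf (zRange U)) :
    ⁅genField U 0 g₁ h₁ k₁, genField U 0 g₂ h₂ k₂⁆ =
      genField U 0 0 0 ((g₂ * h₁.D - (1 / 2 : ℝ) • (g₂.D * h₁))
        - (g₁ * h₂.D - (1 / 2 : ℝ) • (g₁.D * h₂))) := by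
  rw [lie_genField]
  congr 1 <;> refine SmoothMap.ext_on fun z _ => ?_ <;>
    simp [CInf.mul_apply, CInf.D_zero]

variable (U) in
/-- The Lie algebra of all fields `Y(g) + X(h) + W(k)`. -/
def heisenbergLoopAlgebra : LieSubalgebra ℝ (VF U) where
  carrier := {V | ∃ g h k, V = genField U 0 g h k}
  add_mem' := by
    rintro _ _ ⟨g, h, k, rfl⟩ ⟨g', h', k', rfl⟩
    exact ⟨_, _, _, by rw [genField_add, add_zero]⟩
  zero_mem' := ⟨0, 0, 0, genField_zero.symm⟩
  smul_mem' := by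
    rintro c _ ⟨g, h, k, rfl⟩
    exact ⟨_, _, _, by rw [genField_smul, smul_zero]⟩
  lie_mem' := by
    rintro _ _ ⟨g, h, k, rfl⟩ ⟨g', h', k', rfl⟩
    exact ⟨_, _, _, lie_genField_YXW _ _ _ _ _ _⟩

theorem lie_Z_Z (f₁ f₂ : CInf (zRange U)) : ⁅Z U f₁, Z U f₂⁆ = Z U (f₁ * f₂.D - f₁.D * f₂) := by
  rw [← genField_Z, ← genField_Z, ← genField_Z, lie_genField]
  congr 1 <;> refine SmoothMap.ext_on fun z _ => ?_ <;>
    simp [CInf.mul_apply, CInf.D_zero]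

theorem lie_Z_Y (f g : CInf (zRange U)) :
    ⁅Z U f, Y U g⁆ = Y U (f * g.D - (1 / 2 : ℝ) • (f.D * g)) := by
  rw [← genField_Z, ← genField_Y, ← genField_Y, lie_genField]
  congr 1 <;> refine SmoothMap.ext_on fun z _ => ?_ <;>
    simp [CInf.mul_apply, CInf.D_zero]

theorem lie_Z_X (f h : CInf (zRange U)) :
    ⁅Z U f, X U h⁆ = X U (f * h.D - (1 / 4 : ℝ) • (f.D * h)) := by
  rw [← genField_Z, ← genField_X, ← genField_X, lie_genField]
  congr 1 <;> refine SmoothMap.ext_on fun z _ => ?_ <;>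
    simp [CInf.mul_apply, CInf.D_zero]

theorem lie_Z_W (f k : CInf (zRange U)) :
    ⁅Z U f, W U k⁆ = W U (f * k.D + (1 / 4 : ℝ) • (f.D * k)) := by
  rw [← genField_Z, ← genField_W, ← genField_W, lie_genField]
  congr 1 <;> refine SmoothMap.ext_on fun z _ => ?_ <;>
    simp [CInf.mul_apply, CInf.D_zero]

theorem lie_X_Y (g h : CInf (zRange U)) :
    ⁅X U h, Y U g⁆ = W U (g * h.D - (1 / 2 : ℝ) • (g.D * h)) := by
  rw [← genField_X, ← genField_Y, ← genField_W, lie_genField_YXW]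
  congr 1
  refine SmoothMap.ext_on fun z _ => ?_
  simp [CInf.mul_apply, CInf.D_zero]

theorem lie_X_X (g h : CInf (zRange U)) : ⁅X U g, X U h⁆ = 0 := by
  rw [← genField_X, ← genField_X, lie_genField_YXW, ← genField_zero]
  congr 1
  refine SmoothMap.ext_on fun z _ => ?_
  simp [CInf.mul_apply, CInf.D_zero]

theorem lie_Y_Y (g h : CInf (zRange U)) : ⁅Y U g, Y U h⁆ = 0 := by
  rw [← genField_Y, ← genField_Y, lie_genField_YXW, ← genField_zero]
  congr 1
  refine SmoothMap.ext_on fun z _ => ?_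
  simp [CInf.mul_apply, CInf.D_zero]

theorem lie_X_W (g h : CInf (zRange U)) : ⁅X U g, W U h⁆ = 0 := by
  rw [← genField_X, ← genField_W, lie_genField_YXW, ← genField_zero]
  congr 1
  refine SmoothMap.ext_on fun z _ => ?_
  simp [CInf.mul_apply, CInf.D_zero]

theorem lie_Y_W (g h : CInf (zRange U)) : ⁅Y U g, W U h⁆ = 0 := by
  rw [← genField_Y, ← genField_W, lie_genField_YXW, ← genField_zero]
  congr 1
  refine SmoothMap.ext_on fun z _ => ?_
  simp [CInf.mul_apply, CInf.D_zero]

theorem lie_W_W (g h : CInf (zRange U)) : ⁅W U g, W U h⁆ = 0 := by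
  rw [← genField_W, ← genField_W, lie_genField_YXW, ← genField_zero]
  congr 1
  refine SmoothMap.ext_on fun z _ => ?_
  simp [CInf.D_zero]

/-! ### The homomorphism from vector fields on the z-range and the Witt relations -/

theorem lie_toVF {J : Opens ℝ} (f g : CInf J) : ⁅f.toVF, g.toVF⁆ = (f * g.D - f.D * g).toVF := by
  refine VF.ext_on fun z hz => ?_
  have hf := (f.hasDerivAt hz).hasFDerivAt.fderiv
  have hg := (g.hasDerivAt hz).hasFDerivAt.fderiv
  rw [VF.lie_apply _ _ hz, lieBracket_eq]
  have e : (fderiv ℝ g.1 z) (f.1 z) - (fderiv ℝ f.1 z) (g.1 z) =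
      f.1 z * g.D.1 z - f.D.1 z * g.1 z := by
    rw [hf, hg]
    simp
    ring
  exact e

theorem Z_add (f f' : CInf (zRange U)) : Z U (f + f') = Z U f + Z U f' := by
  rw [← genField_Z, ← genField_Z, ← genField_Z, genField_add]
  simp

theorem Z_smul (c : ℝ) (f : CInf (zRange U)) : Z U (c • f) = c • Z U f := by
  rw [← genField_Z, ← genField_Z, genField_smul]
  simp

variable (U) in
/-- The homomorphism `f ∂_z ↦ Z(f)` from the vector fields on the `z`-range. -/
def virasoroHom : VF (zRange U) →ₗ⁅ℝ⁆ VF U where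
  toFun V := Z U V
  map_add' V V' := Z_add (U := U) V V'
  map_smul' c V := Z_smul (U := U) c V
  map_lie' {V V'} := by
    refine Eq.trans ?_ (lie_Z_Z (U := U) V V').symm
    exact congrArg (Z U) (lie_toVF (J := zRange U) V V')

theorem virasoroHom_toVF (f : CInf (zRange U)) : virasoroHom U f.toVF = Z U f := rfl

theorem Z_injective : Function.Injective (Z U) := fun f f' h => by
  rw [← genField_Z, ← genField_Z] at h
  exact (genField_injective h).1

theorem contDiffOn_neg_zpow {J : Opens ℝ} (h0 : (0 : ℝ) ∉ J) (n : ℤ) :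
    ContDiffOn ℝ ∞ (fun z : ℝ => -z ^ n) J := by
  refine ContDiffOn.neg ?_
  have hne : ∀ z ∈ (J : Set ℝ), z ≠ 0 := fun z hz h => h0 (h ▸ hz)
  cases n with
  | ofNat n => simpa using (contDiff_id.pow n).contDiffOn
  | negSucc n =>
    simp only [zpow_negSucc]
    exact ContDiffOn.inv (contDiff_id.pow (n + 1)).contDiffOn fun z hz => pow_ne_zero _ (hne z hz)

/-- The Witt algebra relations for the fields `Z(-z ^ (n + 1))`. -/
theorem exists_witt_basis (h0 : (0 : ℝ) ∉ zRange U) : ∃ ℓ : ℤ → CInf (zRange U),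
    (∀ n : ℤ, ∀ z ∈ zRange U, (ℓ n).1 z = -z ^ (n + 1)) ∧
      ∀ m n : ℤ, ⁅Z U (ℓ m), Z U (ℓ n)⁆ = ((m : ℝ) - n) • Z U (ℓ (m + n)) := by
  have hℓ : ∀ n : ℤ, ∀ z ∈ zRange U,
      (ofSmoothOn (zRange U) _ (contDiffOn_neg_zpow h0 (n + 1))).1 z = -z ^ (n + 1) :=
    fun n z hz => ofSmoothOn_apply _ hz
  refine ⟨fun n => ofSmoothOn _ _ (contDiffOn_neg_zpow h0 (n + 1)), hℓ, fun m n => ?_⟩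
  have hD : ∀ n : ℤ, ∀ z ∈ zRange U,
      (CInf.D (ofSmoothOn (zRange U) _ (contDiffOn_neg_zpow h0 (n + 1)))).1 z =
        -((n + 1) * z ^ n) := by
    intro n z hz
    have hne : z ≠ 0 := fun h => h0 (h ▸ hz)
    have h := (hasDerivAt_zpow (n + 1) z (Or.inl hne)).neg
    rw [CInf.D_apply _ hz]
    refine (Filter.EventuallyEq.deriv_eq ?_).trans (h.deriv.trans (by simp))
    filter_upwards [(zRange U).isOpen.mem_nhds hz] with y hy
    exact hℓ n y hy
  -- For f₁ = -z^(m+1) and f₂ = -z^(n+1), f₁f₂' - f₁'f₂ = (n - m) z^(m+n+1); the minus sign in the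
  -- definition of the basis turns this into the factor m - n.
  rw [lie_Z_Z, ← Z_smul]
  congr 1
  refine SmoothMap.ext_on fun z hz => ?_
  have hne : z ≠ 0 := fun h => h0 (h ▸ hz)
  rw [CInf.sub_apply, CInf.mul_apply, CInf.mul_apply, CInf.smul_apply, hD m z hz, hD n z hz,
    hℓ m z hz, hℓ n z hz, hℓ (m + n) z hz, zpow_add_one₀ hne, zpow_add_one₀ hne,
    zpow_add_one₀ hne, zpow_add₀ hne]
  ring

end

section

variable {U : Opens (Fin 4 → ℝ)}

/-! ### The loop algebra -/

namespace Loop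

variable {J : Opens ℝ} {n : ℕ}

/-- The coefficient of a loop along `A_i`. -/
def coordA (i : Fin n) (c : Loop J n) : CInf J :=
  ⟨fun z => (c.1 z).a i, contDiffOn_pi.1 (ContDiff.comp_contDiffOn contDiff_fst c.2.1) i,
    fun z hz => congrArg (fun v : Heis n => v.a i) (c.2.2 z hz)⟩

/-- The coefficient of a loop along `B_i`. -/
def coordB (i : Fin n) (c : Loop J n) : CInf J :=
  ⟨fun z => (c.1 z).b i, contDiffOn_pi.1 (ContDiff.comp_contDiffOn contDiff_fst
    (ContDiff.comp_contDiffOn contDiff_snd c.2.1)) i,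
    fun z hz => congrArg (fun v : Heis n => v.b i) (c.2.2 z hz)⟩

/-- The coefficient of a loop along `H`. -/
def coordC (c : Loop J n) : CInf J :=
  ⟨fun z => (c.1 z).c,
    ContDiffOn.snd (ContDiffOn.snd (E := ℝ) (F := Fin n → ℝ) (G := (Fin n → ℝ) × ℝ) c.2.1),
    fun z hz => congrArg (fun v : Heis n => v.c) (c.2.2 z hz)⟩

theorem ext_on {c d : Loop J n} (h : ∀ z ∈ J, c.1 z = d.1 z) : c = d := SmoothMap.ext_on h

/-- The constant loops. -/
def const : Heis n →ₗ⁅ℝ⁆ Loop J n where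
  toFun v := ofSmoothOn J (fun _ => v) contDiffOn_const
  map_add' u v := ext_on fun z hz => by
    refine (ofSmoothOn_apply _ hz).trans ?_
    exact congrArg₂ (· + ·) (ofSmoothOn_apply (f := fun _ => u) contDiffOn_const hz).symm
      (ofSmoothOn_apply (f := fun _ => v) contDiffOn_const hz).symm
  map_smul' r v := ext_on fun z hz => by
    refine (ofSmoothOn_apply _ hz).trans ?_
    exact congrArg (r • ·) (ofSmoothOn_apply (f := fun _ => v) contDiffOn_const hz).symm
  map_lie' {u v} := ext_on fun z hz => by
    refine (ofSmoothOn_apply _ hz).trans ?_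
    exact congrArg₂ (fun a b : Heis n => ⁅a, b⁆)
      (ofSmoothOn_apply (f := fun _ => u) contDiffOn_const hz).symm
      (ofSmoothOn_apply (f := fun _ => v) contDiffOn_const hz).symm

theorem const_apply (v : Heis n) {z : ℝ} (hz : z ∈ J) : (const v : Loop J n).1 z = v :=
  ofSmoothOn_apply (f := fun _ => v) contDiffOn_const hz

end Loop

theorem contDiffOn_heisField (c : Loop (zRange U) 2) :
    ContDiffOn ℝ ∞ (fun p : Fin 4 → ℝ => heisField (c.1 (p 2)) p) U :=
  vec4 (comp_z (c.coordA 0).2.1) (comp_z (c.coordA 1).2.1) contDiffOn_const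
    ((((comp_z (c.coordB 0).2.1).mul (coord 0)).add ((comp_z (c.coordB 1).2.1).mul (coord 1))).add
      (comp_z c.coordC.2.1))

variable (U) in
/-- The vector field of a loop. -/
def loopField (c : Loop (zRange U) 2) : VF U := ofSmoothOn U _ (contDiffOn_heisField c)

theorem loopField_apply (c : Loop (zRange U) 2) {p : Fin 4 → ℝ} (hp : p ∈ U) :
    (loopField U c).1 p = heisField (c.1 (p 2)) p :=
  ofSmoothOn_apply (contDiffOn_heisField c) hp

theorem heisField_add (u v : Heis 2) (p : Fin 4 → ℝ) :
    heisField (u + v) p = heisField u p + heisField v p := by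
  funext i
  fin_cases i <;> simp [heisField]
  ring

theorem heisField_smul (r : ℝ) (v : Heis 2) (p : Fin 4 → ℝ) :
    heisField (r • v) p = r • heisField v p := by
  funext i
  fin_cases i <;> simp [heisField]
  ring

/-- The fields have no ∂_z component, so each differentiates the other at fixed z and the loop
coefficients behave as constants. Only the derivatives of b_0 x + b_1 y survive, which give the
Heisenberg bracket. -/
theorem lie_loopField (c d : Loop (zRange U) 2) :
    ⁅loopField U c, loopField U d⁆ = loopField U ⁅c, d⁆ := by
  refine VF.ext_on fun p hp => ?_
  rw [loopField_apply _ hp]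
  have s0 : ∀ a b c d : ℝ, ![a, b, c, d] 0 = a := fun _ _ _ _ => rfl
  have s1 : ∀ a b c d : ℝ, ![a, b, c, d] 1 = b := fun _ _ _ _ => rfl
  have s2 : ∀ a b c d : ℝ, ![a, b, c, d] 2 = c := fun _ _ _ _ => rfl
  have s3 : ∀ a b c d : ℝ, ![a, b, c, d] 3 = d := fun _ _ _ _ => rfl
  have hl : (⁅c, d⁆ : Loop (zRange U) 2).1 (p 2) = ⁅c.1 (p 2), d.1 (p 2)⁆ := rfl
  have h0 : ∀ (c : Loop (zRange U) 2) (v : Fin 4 → ℝ), v 2 = 0 →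
      fderiv ℝ ((loopField U c).comp 0).1 p v = 0 := by
    intro c v hv
    rw [fderiv_comp_eq hp (F := fun q => (c.coordA 0).1 (q 2))
      (fun q hq => by rw [loopField_apply c hq]; rfl) ((c.coordA 0).hasFDerivAt_comp_z hp)]
    simp [hv]
  have h1 : ∀ (c : Loop (zRange U) 2) (v : Fin 4 → ℝ), v 2 = 0 →
      fderiv ℝ ((loopField U c).comp 1).1 p v = 0 := by
    intro c v hv
    rw [fderiv_comp_eq hp (F := fun q => (c.coordA 1).1 (q 2))
      (fun q hq => by rw [loopField_apply c hq]; rfl) ((c.coordA 1).hasFDerivAt_comp_z hp)]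
    simp [hv]
  have h2 : ∀ (c : Loop (zRange U) 2) (v : Fin 4 → ℝ),
      fderiv ℝ ((loopField U c).comp 2).1 p v = 0 := by
    intro c v
    rw [fderiv_comp_eq hp (F := fun q => 0)
      (fun q hq => by rw [loopField_apply c hq]; rfl) (hasFDerivAt_const _ _)]
    simp
  have h3 : ∀ (c : Loop (zRange U) 2) (v : Fin 4 → ℝ), v 2 = 0 →
      fderiv ℝ ((loopField U c).comp 3).1 p v =
        (c.1 (p 2)).b 0 * v 0 + (c.1 (p 2)).b 1 * v 1 := by
    intro c v hv
    rw [fderiv_comp_eq hp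
      (F := fun q => (c.coordB 0).1 (q 2) * q 0 + (c.coordB 1).1 (q 2) * q 1 + c.coordC.1 (q 2))
      (fun q hq => by rw [loopField_apply c hq]; rfl)
      (((((c.coordB 0).hasFDerivAt_comp_z hp).mul (hasFDerivAt_coord 0 p)).add
        (((c.coordB 1).hasFDerivAt_comp_z hp).mul (hasFDerivAt_coord 1 p))).add
        (c.coordC.hasFDerivAt_comp_z hp))]
    simp [hv, Loop.coordB]
  have hz : ∀ c : Loop (zRange U) 2, (loopField U c).1 p 2 = 0 := fun c => by
    rw [loopField_apply c hp]; rfl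
  funext i
  rw [VF.lie_comp _ _ hp i, hl, Heis.lie_def]
  match i with
  | 0 => simp [h0 _ _ (hz _), heisField]
  | 1 => simp [h1 _ _ (hz _), heisField]
  | 2 => simp [h2, heisField]
  | 3 =>
    rw [h3 _ _ (hz _), h3 _ _ (hz _)]
    simp only [loopField_apply _ hp, heisField, s0, s1, s3, Heis.a_mk, Heis.b_mk,
      Heis.c_mk, dotProduct, Fin.sum_univ_two, Pi.zero_apply]
    ring

variable (U) in
/-- The realization of the loop algebra by vector fields on `U`. -/
def loopHom : Loop (zRange U) 2 →ₗ⁅ℝ⁆ VF U where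
  toFun := loopField U
  map_add' c d := VF.ext_on fun p hp => by
    rw [VF.add_coe, Pi.add_apply, loopField_apply _ hp, loopField_apply _ hp,
      loopField_apply _ hp]
    exact heisField_add _ _ _
  map_smul' r c := VF.ext_on fun p hp => by
    rw [RingHom.id_apply, VF.smul_coe, Pi.smul_apply, loopField_apply _ hp, loopField_apply _ hp]
    exact heisField_smul _ _ _
  map_lie' {c d} := (lie_loopField c d).symm

theorem loopHom_apply (c : Loop (zRange U) 2) {p : Fin 4 → ℝ} (hp : p ∈ U) :
    (loopHom U c).1 p = heisField (c.1 (p 2)) p := loopField_apply c hp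

/-- An element of the Heisenberg algebra is determined by its field near a point, on a slice of
constant `z`. -/
theorem heisField_injective {p : Fin 4 → ℝ} (hp : p ∈ U) {u v : Heis 2}
    (h : ∀ q ∈ U, q 2 = p 2 → heisField u q = heisField v q) : u = v := by
  have key : ∀ i : Fin 4, ∃ t : ℝ, t ≠ 0 ∧ p + t • (Pi.single i 1 : Fin 4 → ℝ) ∈ U := by
    intro i
    have hc : Continuous fun t : ℝ => p + t • (Pi.single i 1 : Fin 4 → ℝ) := by fun_prop
    have hm : ∀ᶠ t in nhdsWithin (0 : ℝ) {0}ᶜ, p + t • (Pi.single i 1 : Fin 4 → ℝ) ∈ U := by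
      refine (hc.continuousAt.eventually (U.isOpen.mem_nhds ?_)).filter_mono nhdsWithin_le_nhds
      simpa using hp
    obtain ⟨t, ht, ht0⟩ := (hm.and self_mem_nhdsWithin).exists
    exact ⟨t, ht0, ht⟩
  obtain ⟨s, hs, hsU⟩ := key 0
  obtain ⟨t, ht, htU⟩ := key 1
  have e := h p hp rfl
  have e0 := congrFun e 0
  have e1 := congrFun e 1
  have e3 := congrFun e 3
  have es := congrFun (h _ hsU (by simp)) 3
  have et := congrFun (h _ htU (by simp)) 3
  simp [heisField] at e0 e1 e3 es et
  -- Subtracting the w-components at p and at a point displaced along x isolates b_0; a displacement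
  -- along y isolates b_1.
  have b0 : u.b 0 = v.b 0 := mul_right_cancel₀ hs (by linarith)
  have b1 : u.b 1 = v.b 1 := mul_right_cancel₀ ht (by linarith)
  refine Heis.ext' ?_ ?_ ?_
  · funext i
    fin_cases i
    · exact e0
    · exact e1
  · funext i
    fin_cases i
    · exact b0
    · exact b1
  · rw [b0, b1] at e3
    linarith

theorem loopHom_injective : Function.Injective (loopHom U) := fun c d h =>
  Loop.ext_on fun z hz => by
    obtain ⟨p, hp, rfl⟩ := hz
    refine heisField_injective hp fun q hq hqp => ?_
    have hqp' : q 2 = (fun p : Fin 4 → ℝ => p 2) p := hqp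
    rw [← hqp', ← loopHom_apply c hq, ← loopHom_apply d hq, h]

/-! ### The loops of the fields Y(g) + X(h) + W(k) -/

theorem kmLoop_apply {J : Opens ℝ} (g h k : CInf J) {z : ℝ} (hz : z ∈ J) :
    (kmLoop g h k).1 z =
      Heis.mk ![h.1 z, g.1 z] ![-(1 / 2) * g.D.1 z, -h.D.1 z] (k.1 z) := by
  rw [CInf.D_apply g hz, CInf.D_apply h hz]
  exact ofSmoothOn_apply _ hz

theorem loopHom_kmLoop (g h k : CInf (zRange U)) :
    loopHom U (kmLoop g h k) = genField U 0 g h k := VF.ext_on fun p hp => by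
  rw [loopHom_apply _ hp, genField_apply _ _ _ _ hp, kmLoop_apply g h k (mem_zRange hp)]
  funext i
  fin_cases i <;> simp [heisField, CInf.D_zero]
  ring

theorem contDiffOn_affine {J : Opens ℝ} (r s : ℝ) : ContDiffOn ℝ ∞ (fun z : ℝ => r + s * z) J := by
  fun_prop

/-- The affine function `z ↦ r + s z` on `J`. -/
def affineFn (J : Opens ℝ) (r s : ℝ) : CInf J := ofSmoothOn J _ (contDiffOn_affine r s)

theorem affineFn_apply {J : Opens ℝ} (r s : ℝ) {z : ℝ} (hz : z ∈ J) :
    (affineFn J r s).1 z = r + s * z := ofSmoothOn_apply (contDiffOn_affine r s) hz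

theorem affineFn_D {J : Opens ℝ} (r s : ℝ) {z : ℝ} (hz : z ∈ J) : (affineFn J r s).D.1 z = s := by
  have h : HasDerivAt (fun z : ℝ => r + s * z) s z := by
    simpa using ((hasDerivAt_id z).const_mul s).const_add r
  rw [CInf.D_apply _ hz]
  refine (Filter.EventuallyEq.deriv_eq ?_).trans h.deriv
  filter_upwards [J.isOpen.mem_nhds hz] with y hy
  exact affineFn_apply r s hy

theorem exists_kmLoop_eq {J : Opens ℝ} {z : ℝ} (hz : z ∈ J) (v : Heis 2) :
    ∃ g h k : CInf J, (kmLoop g h k).1 z = v := by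
  -- Affine functions of z with prescribed value and slope at the given point: g has value a_1 and
  -- slope -2 b_0, h has value a_0 and slope -b_1.
  refine ⟨affineFn J (v.a 1 + 2 * v.b 0 * z) (-2 * v.b 0), affineFn J (v.a 0 + v.b 1 * z) (-v.b 1),
    affineFn J v.c 0, ?_⟩
  rw [kmLoop_apply _ _ _ hz]
  simp only [affineFn_apply _ _ hz, affineFn_D _ _ hz]
  refine Heis.ext' (funext fun i => ?_) (funext fun i => ?_) ?_
  · fin_cases i <;> simp
  · fin_cases i <;> simp
  · simp

/-- The loops `kmLoop g h k` span the loop algebra over the smooth functions of `z`. -/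
theorem exists_eq_sum_kmLoop {J : Opens ℝ} (c : Loop J 2) :
    ∃ (n : ℕ) (a g h k : Fin n → CInf J),
      ∀ z ∈ J, c.1 z = ∑ i, (a i).1 z • (kmLoop (g i) (h i) (k i)).1 z := by
  -- The five loops are A_0, A_1, z A_1 - (1/2) B_0, z A_0 - B_1 and H. The terms b_1 z and 2 b_0 z
  -- in the first two coefficients cancel the A-parts of the third and fourth loops.
  refine ⟨5, ![c.coordA 0 + c.coordB 1 * affineFn J 0 1,
      c.coordA 1 + (2 : ℝ) • (c.coordB 0 * affineFn J 0 1), (-2 : ℝ) • c.coordB 0, -c.coordB 1,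
      c.coordC],
    ![affineFn J 0 0, affineFn J 1 0, affineFn J 0 1, affineFn J 0 0, affineFn J 0 0],
    ![affineFn J 1 0, affineFn J 0 0, affineFn J 0 0, affineFn J 0 1, affineFn J 0 0],
    ![affineFn J 0 0, affineFn J 0 0, affineFn J 0 0, affineFn J 0 0, affineFn J 1 0],
    fun z hz => ?_⟩
  rw [Fin.sum_univ_five]
  simp only [kmLoop_apply _ _ _ hz]
  simp only [Matrix.cons_val, affineFn_apply _ _ hz, affineFn_D _ _ hz, CInf.add_apply,
    CInf.mul_apply, CInf.smul_apply]
  have hA : ∀ i, (c.coordA i).1 z = (c.1 z).a i := fun _ => rfl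
  have hB : ∀ i, (c.coordB i).1 z = (c.1 z).b i := fun _ => rfl
  have hC : c.coordC.1 z = (c.1 z).c := rfl
  have hn : (-c.coordB 1).1 z = -(c.1 z).b 1 := rfl
  rw [hA, hA, hB, hB, hC, hn]
  refine Heis.ext' (funext fun i => ?_) (funext fun i => ?_) ?_
  · fin_cases i <;> simp [-neg_smul]
    ring
  · fin_cases i <;> simp [-neg_smul]
    ring
  · simp [-neg_smul]

theorem finrank_heis : Module.finrank ℝ (Heis 2) = 5 := by
  have h : Module.finrank ℝ ((Fin 2 → ℝ) × (Fin 2 → ℝ) × ℝ) = 5 := by simp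
  exact h

/-! ### The embedding into `sl(4)` -/

/-- The strictly upper triangular matrix of an element of the Heisenberg algebra. -/
def heisMatrix (v : Heis 2) : Matrix (Fin 4) (Fin 4) ℝ :=
  !![0, v.b 0, v.b 1, -v.c;
     0, 0, 0, v.a 0;
     0, 0, 0, v.a 1;
     0, 0, 0, 0]

theorem heisMatrix_mem_sl (v : Heis 2) :
    heisMatrix v ∈ LieAlgebra.SpecialLinear.sl (Fin 4) ℝ := by
  refine LinearMap.mem_ker.2 ?_
  simp [Matrix.trace, Fin.sum_univ_four, heisMatrix]

/-- The embedding of the Heisenberg algebra into `sl(4)`. -/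
def heisToSl : Heis 2 →ₗ⁅ℝ⁆ LieAlgebra.SpecialLinear.sl (Fin 4) ℝ where
  toFun v := ⟨heisMatrix v, heisMatrix_mem_sl v⟩
  map_add' u v := Subtype.ext <| by
    ext i j
    fin_cases i <;> fin_cases j <;> simp [heisMatrix]
    ring
  map_smul' r v := Subtype.ext <| by
    ext i j
    fin_cases i <;> fin_cases j <;> simp [heisMatrix]
  map_lie' {u v} := Subtype.ext <| by
    change heisMatrix ⁅u, v⁆ = heisMatrix u * heisMatrix v - heisMatrix v * heisMatrix u
    -- Only the corner entry can be nonzero: it is u.b·v.a - v.b·u.a, the negative of the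
    -- H-coordinate of the bracket, which explains the entry -c.
    rw [Heis.lie_def]
    ext i j
    fin_cases i <;> fin_cases j <;>
      simp [heisMatrix, dotProduct]
    ring

theorem heisToSl_injective : Function.Injective heisToSl := fun u v h => by
  have hm : ∀ i j, heisMatrix u i j = heisMatrix v i j := fun i j =>
    congrFun (congrFun (congrArg Subtype.val h) i) j
  refine Heis.ext' (funext fun i => ?_) (funext fun i => ?_) (neg_injective (hm 0 3))
  · fin_cases i
    · exact hm 1 3
    · exact hm 2 3
  · fin_cases i
    · exact hm 0 1
    · exact hm 0 2

end

end HigherKP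

end

/-! ### The theorem -/

open HigherKP in
theorem mainTheorem5 (U : TopologicalSpace.Opens (Fin 4 → ℝ))
    (hconv : Convex ℝ (U : Set (Fin 4 → ℝ))) (hne : (U : Set (Fin 4 → ℝ)).Nonempty) :
    -- the symmetry algebra: a Lie algebra, consisting of the fields Z(f) + Y(g) + X(h) + W(k)
    (∃ S : LieSubalgebra ℝ (VF U),
      (∀ V : VF U, V ∈ S ↔ IsLiePointSymmetry higherKP V) ∧
      (∀ V : VF U, V ∈ S ↔
        ∃ f g h k : CInf (zRange U), V = Z U f + Y U g + X U h + W U k)) ∧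
    -- the functions f, g, h, k are determined by the field
    (∀ f g h k f' g' h' k' : CInf (zRange U),
      Z U f + Y U g + X U h + W U k = Z U f' + Y U g' + X U h' + W U k' →
        f = f' ∧ g = g' ∧ h = h' ∧ k = k') ∧
    -- the Z(f) form a centerless Virasoro algebra
    (∀ f₁ f₂ : CInf (zRange U), ⁅Z U f₁, Z U f₂⁆ = Z U (f₁ * f₂.D - f₁.D * f₂)) ∧
    (∃ ζ : VF (zRange U) →ₗ⁅ℝ⁆ VF U,
      Function.Injective ζ ∧ ∀ f : CInf (zRange U), ζ f.toVF = Z U f) ∧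
    ((0 : ℝ) ∉ zRange U → ∃ ℓ : ℤ → CInf (zRange U),
      (∀ n : ℤ, ∀ z ∈ zRange U, (ℓ n).1 z = -z ^ (n + 1)) ∧
      ∀ m n : ℤ, ⁅Z U (ℓ m), Z U (ℓ n)⁆ = ((m : ℝ) - n) • Z U (ℓ (m + n))) ∧
    -- the action of the Z(f) on the remaining fields
    (∀ f g : CInf (zRange U),
      ⁅Z U f, Y U g⁆ = Y U (f * g.D - (1 / 2 : ℝ) • (f.D * g)) ∧
      ⁅Z U f, X U g⁆ = X U (f * g.D - (1 / 4 : ℝ) • (f.D * g)) ∧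
      ⁅Z U f, W U g⁆ = W U (f * g.D + (1 / 4 : ℝ) • (f.D * g))) ∧
    -- the remaining commutation relations
    (∀ g h : CInf (zRange U),
      ⁅X U h, Y U g⁆ = W U (g * h.D - (1 / 2 : ℝ) • (g.D * h)) ∧
      ⁅X U g, X U h⁆ = 0 ∧ ⁅Y U g, Y U h⁆ = 0 ∧ ⁅X U g, W U h⁆ = 0 ∧
      ⁅Y U g, W U h⁆ = 0 ∧ ⁅W U g, W U h⁆ = 0) ∧
    -- the fields Y(g) + X(h) + W(k) form a Lie algebra of loops in the Heisenberg algebra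
    (∃ K : LieSubalgebra ℝ (VF U),
      (∀ V : VF U, V ∈ K ↔ ∃ g h k : CInf (zRange U), V = Y U g + X U h + W U k) ∧
      ∃ ρ : Loop (zRange U) 2 →ₗ⁅ℝ⁆ VF U,
        Function.Injective ρ ∧
        (∀ c : Loop (zRange U) 2, ∀ p ∈ U, ρ c p = heisField (c (p 2)) p) ∧
        (∀ g h k : CInf (zRange U), ρ (kmLoop g h k) = Y U g + X U h + W U k) ∧
        K ≤ ρ.range) ∧
    -- at each value of the loop parameter these loops fill the Heisenberg algebra
    (∀ z ∈ zRange U, ∀ v : Heis 2, ∃ g h k : CInf (zRange U), kmLoop g h k z = v) ∧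
    -- with functions of z as coefficients they span the whole loop algebra
    (∀ c : Loop (zRange U) 2, ∃ (n : ℕ) (a g h k : Fin n → CInf (zRange U)),
      ∀ z ∈ zRange U, c z = ∑ i, (a i).1 z • kmLoop (g i) (h i) (k i) z) ∧
    -- the underlying Lie algebra of vector fields is the 5-dimensional Heisenberg algebra
    Module.finrank ℝ (Heis 2) = 5 ∧
    (∃ ρ₀ : Heis 2 →ₗ⁅ℝ⁆ VF U,
      Function.Injective ρ₀ ∧ ∀ v : Heis 2, ∀ p ∈ U, ρ₀ v p = heisField v p) ∧
    -- the embedding of the Heisenberg algebra into sl(4, ℝ)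
    (∃ σ : Heis 2 →ₗ⁅ℝ⁆ LieAlgebra.SpecialLinear.sl (Fin 4) ℝ,
      Function.Injective σ ∧
      ∀ v : Heis 2, (σ v).1 =
        !![0, v.b 0, v.b 1, -v.c;
           0, 0, 0, v.a 0;
           0, 0, 0, v.a 1;
           0, 0, 0, 0]) := by
  refine ⟨⟨symmetryAlgebra U, fun V => ⟨?_, fun hV => ?_⟩, fun V => Iff.rfl⟩,
    fun f g h k f' g' h' k' heq => genField_injective heq, lie_Z_Z,
    ⟨virasoroHom U, fun V V' h => Z_injective (U := U) h, virasoroHom_toVF⟩, exists_witt_basis,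
    fun f g => ⟨lie_Z_Y f g, lie_Z_X f g, lie_Z_W f g⟩,
    fun g h => ⟨lie_X_Y g h, lie_X_X g h, lie_Y_Y g h, lie_X_W g h, lie_Y_W g h, lie_W_W g h⟩,
    ⟨heisenbergLoopAlgebra U, fun V => ?_, loopHom U, loopHom_injective,
      fun c p hp => loopHom_apply c hp, fun g h k => ?_, ?_⟩,
    fun z hz v => exists_kmLoop_eq hz v, exists_eq_sum_kmLoop, finrank_heis,
    ⟨(loopHom U).comp Loop.const, fun u v h => ?_, fun v p hp => ?_⟩,
    ⟨heisToSl, heisToSl_injective, fun v => rfl⟩⟩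
  · rintro ⟨f, g, h, k, rfl⟩
    exact (genField_determiningEquations f g h k).isLiePointSymmetry
  · exact (DeterminingEquations.of_isLiePointSymmetry hV).exists_genField hconv
  · simp only [← genField_YXW]
    exact Iff.rfl
  · rw [loopHom_kmLoop, genField_YXW]
  · rintro _ ⟨g, h, k, rfl⟩
    exact ⟨kmLoop g h k, loopHom_kmLoop g h k⟩
  · obtain ⟨p, hp⟩ := hne
    have hL : (Loop.const u : Loop (zRange U) 2) = Loop.const v := loopHom_injective h
    rw [← Loop.const_apply u (mem_zRange hp), hL, Loop.const_apply v (mem_zRange hp)]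
  · refine (loopHom_apply _ hp).trans ?_
    exact congrArg (heisField · p) (Loop.const_apply v (mem_zRange hp))
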